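/- Let $p\ge 1$ be an integer. There is a constant $C$ depending only on $p$ such that the following holds. Let $m\ge 2$, let $\xi_1<\xi_2<\dots<\xi_m$ be real numbers, let $r_1=r_m=p+1$ and $1\le r_j\le p$ for $2\le j\le m-1$, and put $k_j=p-r_j$, $K_j=(\xi_j,\xi_{j+1})$, $h_j=\xi_{j+1}-\xi_j$ $(1\le j\le m-1)$ and $h=\max_j h_j$. Let $\Xi$ be the knot vector in which each $\xi_j$ is repeated $r_j$ times and which contains in addition, for each element $K_j$, the $p-1$ simple knots that divide $K_j$ into $p$ equal parts. Let $\mathcal S_p^{\boldsymbol k}(\Xi)$ be the span of the B-splines of degree $p$ on $\Xi$, defined by the Cox–de Boor recurrence. Write $|v|_{l,K}$ for the $L^2(K)$-norm of the $l$-th weak derivative of $v$ on an open interval $K$, $|v|_l=|v|_{l,(\xi_1,\xi_m)}$, and $|v|_{p+1,h}=\bigl(\sum_{j=1}^{m-1}|v|_{p+1,K_j}^2\bigr)^{1/2}$. Let $u$ be a function on $[\xi_1,\xi_m]$ such that $u|_{K_j}\in H^{p+1}(K_j)$ (continuous representative) for every $1\le j\le m-1$, and $u$ is $C^{k_j}$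 across $\xi_j$ for every $2\le j\le m-1$. Then there is exactly one $\pi_p^{\boldsymbol k}u\in\mathcal S_p^{\boldsymbol k}(\Xi)$, the Hermite interpolant of $u$, with $$(\pi_p^{\boldsymbol k}u)^{(l)}(\xi_j)=u^{(l)}(\xi_j)\ \ (0\le l\le k_j),\qquad (\pi_p^{\boldsymbol k}u)^{(l)}(\xi_j^{\pm})=u^{(l)}(\xi_j^{\pm})\ \ (k_j<l\le p-1)$$ for $2\le j\le m-1$, and $(\pi_p^{\boldsymbol k}u)^{(l)}(\xi_1^{+})=u^{(l)}(\xi_1^{+})$, $(\pi_p^{\boldsymbol k}u)^{(l)}(\xi_m^{-})=u^{(l)}(\xi_m^{-})$ for $0\le l\le p-1$, where $f^{(l)}(\xi^{\pm})$ are the one-sided limits of $f^{(l)}$. It satisfies the local estimate $$|u-\pi_p^{\boldsymbol k}u|_{l,K_j}\le C\,h_j^{\,p+1-l}\,|u|_{p+1,K_j}\qquad(1\le j\le m-1,\ 0\le l\le p),$$ and the global estimate $$|u-\pi_p^{\boldsymbol k}u|_{l}\le C\,h^{\,p+1-l}\,|u|_{p+1,h}\qquad\Bigl(0\le l\le \min\bigl(p,\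 \min_{2\le j\le m-1}k_j+1\bigr)\Bigr),$$ where the inner minimum is omitted if $m=2$. In particular the weak derivatives on the left-hand sides exist in $L^2$. The case $r_2=\dots=r_{m-1}=1$, that is $\mathcal S_p^{\boldsymbol k}(\Xi)\subset C^{p-1}$, is included. -/

import Mathlib

open Filter Topology MeasureTheory
open scoped ENNReal NNReal ContDiff

namespace HermiteSpline

/-- The order-`k` weak derivative of `f` on the open set `K ⊆ ℝ` is `g`
(tested against smooth functions with compact support in `K`). -/
def HasWeakDeriv (k : ℕ) (f g : ℝ → ℝ) (K : Set ℝ) : Prop :=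
  LocallyIntegrableOn f K volume ∧ LocallyIntegrableOn g K volume ∧
    ∀ φ : ℝ → ℝ, ContDiff ℝ ∞ φ → HasCompactSupport φ → tsupport φ ⊆ K →
      ∫ x in K, f x * iteratedDeriv k φ x = (-1) ^ k * ∫ x in K, g x * φ x

/-- `f` belongs to the Sobolev space `H^N(K)`. -/
def MemSobolev (N : ℕ) (f : ℝ → ℝ) (K : Set ℝ) : Prop :=
  ∀ k ≤ N, ∃ g : ℝ → ℝ, HasWeakDeriv k f g K ∧ MemLp g 2 (volume.restrict K)

/-- The Sobolev seminorm `|f|_{l,K}`, the `L²(K)` norm of the `l`-th weak derivative of `f`.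
Weak derivatives are unique almost everywhere, so the infimum runs over a single value; it is
`∞` if there is no weak derivative of order `l`, or if that is not in `L²(K)`. -/
noncomputable def seminormH (l : ℕ) (f : ℝ → ℝ) (K : Set ℝ) : ℝ≥0∞ :=
  ⨅ (g : ℝ → ℝ) (_ : HasWeakDeriv l f g K), eLpNorm g 2 (volume.restrict K)

/-- B-splines of degree `d` over a knot sequence `t`, by the Cox - de Boor recurrence
(with the usual convention `a / 0 = 0`). -/
noncomputable def bspline (t : ℕ → ℝ) : ℕ → ℕ → ℝ → ℝ
  | 0, i, x => Set.indicator (Set.Ico (t i) (t (i + 1))) (fun _ => 1) x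
  | d + 1, i, x =>
      (x - t i) / (t (i + d + 1) - t i) * bspline t d i x +
      (t (i + d + 2) - x) / (t (i + d + 2) - t (i + 1)) * bspline t d (i + 1) x

/-- Degree `p`, breakpoints `ξ 0 < ξ 1 < ... < ξ n` (so `n` elements), and multiplicities
`r 0 = r n = p + 1` and `1 ≤ r j ≤ p` at the interior breakpoints. Values of `ξ` and `r`
at indices above `n` play no role. -/
structure IsOpenKnots (p n : ℕ) (ξ : ℕ → ℝ) (r : ℕ → ℕ) : Prop where
  degree_pos : 1 ≤ p
  elements_pos : 1 ≤ n
  lt_succ : ∀ j < n, ξ j < ξ (j + 1)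
  first : r 0 = p + 1
  last : r n = p + 1
  interior : ∀ j, 0 < j → j < n → 1 ≤ r j ∧ r j ≤ p

/-- The knot vector: each breakpoint `ξ j` repeated `r j` times, and in each element the `p - 1`
simple knots that divide it into `p` equal parts. -/
noncomputable def knotList (p n : ℕ) (ξ : ℕ → ℝ) (r : ℕ → ℕ) : List ℝ :=
  (List.range n).flatMap (fun j =>
      List.replicate (r j) (ξ j) ++
      (List.range (p - 1)).map
        (fun i => ξ j + (((i + 1 : ℕ) : ℝ) / (p : ℝ)) * (ξ (j + 1) - ξ j))) ++
    List.replicate (r n) (ξ n)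

/-- The B-spline space of degree `p`: the span of the `N = (number of knots) - (p + 1)`
B-splines on the knot vector. -/
noncomputable def splineSpace (p n : ℕ) (ξ : ℕ → ℝ) (r : ℕ → ℕ) : Submodule ℝ (ℝ → ℝ) :=
  Submodule.span ℝ
    {B | ∃ i < (knotList p n ξ r).length - (p + 1),
      B = bspline (fun k => (knotList p n ξ r).getD k 0) p i}

/-- The open element `K_j`. -/
def element (ξ : ℕ → ℝ) (j : ℕ) : Set ℝ := Set.Ioo (ξ j) (ξ (j + 1))

/-- Element-wise `H^{p+1}` functions that are `C^{p - r j}` across each interior breakpoint.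
As usual in one dimension, elements of `H^{p+1}(K_j)` are continuous representatives. (At the two
end points the smoothness index is `p - (p + 1) = -1`: no condition.) -/
def MemBrokenSobolev (p n : ℕ) (ξ : ℕ → ℝ) (r : ℕ → ℕ) (u : ℝ → ℝ) : Prop :=
  (∀ j < n, ContinuousOn u (element ξ j) ∧ MemSobolev (p + 1) u (element ξ j)) ∧
  ∀ j, 0 < j → j < n → ContDiffAt ℝ ((p - r j : ℕ) : WithTop ℕ∞) u (ξ j)

/-- The `l`-th derivatives of `f` and `g` have the same (finite) limit along the filter `F`;
with `F = 𝓝[<] a` or `F = 𝓝[>] a` this says `f^{(l)}(a⁻) = g^{(l)}(a⁻)`, resp.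
`f^{(l)}(a⁺) = g^{(l)}(a⁺)`. -/
def SameDerivLimit (l : ℕ) (f g : ℝ → ℝ) (F : Filter ℝ) : Prop :=
  ∃ c : ℝ, Tendsto (iteratedDeriv l f) F (𝓝 c) ∧ Tendsto (iteratedDeriv l g) F (𝓝 c)

/-- `s` is a Hermite interpolant of `u`: it is in the spline space; at each interior breakpoint
the derivatives of order `≤ p - r j` agree, and the one-sided derivatives of order
`p - r j + 1, ..., p - 1` agree on both sides; at the two end points the derivatives
of order `0, ..., p - 1`, taken from inside the interval, agree. -/
structure IsHermiteInterpolant (p n : ℕ) (ξ : ℕ → ℝ) (r : ℕ → ℕ) (u s : ℝ → ℝ) : Prop where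
  mem : s ∈ splineSpace p n ξ r
  twoSided : ∀ j, 0 < j → j < n → ∀ l ≤ p - r j,
    iteratedDeriv l s (ξ j) = iteratedDeriv l u (ξ j)
  oneSided : ∀ j, 0 < j → j < n → ∀ l, p - r j < l → l ≤ p - 1 →
    SameDerivLimit l s u (𝓝[<] (ξ j)) ∧ SameDerivLimit l s u (𝓝[>] (ξ j))
  first : ∀ l ≤ p - 1, SameDerivLimit l s u (𝓝[>] (ξ 0))
  last : ∀ l ≤ p - 1, SameDerivLimit l s u (𝓝[<] (ξ n))

/-- The mesh size `h = max_j h_j`. -/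
noncomputable def meshSize (n : ℕ) (ξ : ℕ → ℝ) : ℝ≥0∞ :=
  (Finset.range n).sup (fun j => ENNReal.ofReal (ξ (j + 1) - ξ j))

/-- The broken seminorm `|u|_{k,h} = (∑_j |u|_{k,K_j}²)^{1/2}`. -/
noncomputable def brokenSeminorm (k n : ℕ) (ξ : ℕ → ℝ) (u : ℝ → ℝ) : ℝ≥0∞ :=
  (∑ j ∈ Finset.range n, seminormH k u (element ξ j) ^ 2) ^ (1 / 2 : ℝ)

end HermiteSpline

/-!
On one element the claim is elementary. A spline of degree `p` there has `p - 1` simple interior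
knots, so its `p`-th derivative is a step function `σ` on `p` equal parts, and matching the
derivatives of order `< p` at the left end point `a` fixes everything but `σ`. Matching them at
the right end point means that the error `e = u - s` satisfies `∫ e^(p) q = 0` for all polynomials
`q` of degree `< p` (`RightChain.integral_mul_polynomial`). Testing with the derivatives of the
polynomials that interpolate a unit step at the subdivision points recovers the values of
`σ - u^(p)(a)` from `w = u^(p) - u^(p)(a)`, so that `|e^(p)|` is bounded by a multiple of
`sup |w|`, with a factor that scaling makes depend on `p` only (`exists_step_bound`). With `u = 0` this is
uniqueness, hence by a count of parameters also existence (`exists_locSpline_hermite`). As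
`|w| ≤ h^{1/2} |u|_{p+1}` by the Cauchy–Schwarz inequality, and each integration from `a` gains a
factor `h`, it is also the local error estimate (`exists_element_estimate`).

All derivatives of the error of order `< p` vanish at both ends of every element. Hence
integration by parts against an arbitrary smooth function leaves no boundary terms, the elementwise
derivatives of the error are its weak derivatives on the whole interval
(`IsOpenKnots.hasWeakDeriv_glue`), and the squared local estimates add up to the global one.

Two facts connect this with the definitions. First, the B-splines span exactly the piecewise
polynomials with the smoothness prescribed by the knots (`IsOpenKnots.splineSpace_eq_pieceSpace`).
Marsden's identity, expanded at a knot and cut off there, shows that the truncated powers belong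
to the span of the B-splines (`truncPow_mem_span`). They are linearly independent and as many as the
B-splines, so the two spans agree; no smoothness of B-splines has to be proved. Second, a
continuous function in `H^{p+1}` of an interval extends to a function of class `C^p` on the line
whose `p`-th derivative is a primitive of the weak derivative of order `p + 1`
(`MemSobolev.exists_chain`, from the du Bois-Reymond lemma); so the one-sided limits of its
derivatives exist.
-/

namespace HermiteSpline

/-! ### Marsden's identity -/

open Polynomial in
/-- The dual polynomial `∏_{k=1}^{d} (Y - t_{i+k})` of the B-spline of degree `d` and index `i`. -/
noncomputable def dualPoly (t : ℕ → ℝ) (d i : ℕ) : ℝ[X] :=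
  ∏ k ∈ Finset.Ioo i (i + d + 1), (X - C (t k))

/-- The power `(x - τ)^e` cut off outside `[τ, b)`. -/
noncomputable def truncPow (b τ : ℝ) (e : ℕ) (x : ℝ) : ℝ :=
  if τ ≤ x ∧ x < b then (x - τ) ^ e else 0

lemma bspline_congr {t t' : ℕ → ℝ} (d i : ℕ) (h : ∀ k ≤ i + d + 1, t k = t' k) :
    bspline t d i = bspline t' d i := by
  induction d generalizing i with
  | zero => ext x; simp only [bspline]; rw [h i (by omega), h (i + 1) (by omega)]
  | succ d ih =>
    ext x
    simp only [bspline]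
    rw [ih i (fun k hk => h k (by omega)), ih (i + 1) (fun k hk => h k (by omega)),
      h i (by omega), h (i + d + 1) (by omega), h (i + d + 2) (by omega), h (i + 1) (by omega)]

lemma bspline_eq_zero_of_lt {t : ℕ → ℝ} (ht : Monotone t) (d i : ℕ) {x : ℝ} (hx : x < t i) :
    bspline t d i x = 0 := by
  induction d generalizing i with
  | zero => simp [bspline, hx]
  | succ d ih =>
    simp only [bspline]
    rw [ih i hx, ih (i + 1) (hx.trans_le (ht (by omega)))]; simp

lemma bspline_eq_zero_of_ge {t : ℕ → ℝ} (ht : Monotone t) (d i : ℕ) {x : ℝ}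
    (hx : t (i + d + 1) ≤ x) : bspline t d i x = 0 := by
  induction d generalizing i with
  | zero =>
    have hx' : ¬ x < t (i + 1) := not_lt.2 hx
    simp [bspline, hx']
  | succ d ih =>
    simp only [bspline]
    rw [ih i ((ht (by omega)).trans hx), ih (i + 1) ((ht (by omega)).trans hx)]; simp

lemma dualPoly_succ_right (t : ℕ → ℝ) (d i : ℕ) :
    dualPoly t (d + 1) i = dualPoly t d i * (.X - .C (t (i + d + 1))) := by
  unfold dualPoly
  rw [← Finset.Ico_succ_left_eq_Ioo, ← Finset.Ico_succ_left_eq_Ioo]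
  simp only [Order.succ_eq_add_one]
  rw [show i + (d + 1) + 1 = (i + d + 1) + 1 by ring, Finset.prod_Ico_succ_top (by omega)]

lemma dualPoly_succ_left (t : ℕ → ℝ) (d i : ℕ) :
    dualPoly t (d + 1) i = (.X - .C (t (i + 1))) * dualPoly t d (i + 1) := by
  unfold dualPoly
  rw [← Finset.Ico_succ_left_eq_Ioo, ← Finset.Ico_succ_left_eq_Ioo]
  simp only [Order.succ_eq_add_one]
  rw [Finset.prod_eq_prod_Ico_succ_bot (by omega)]
  congr 2
  congr 1
  ring

open Polynomial in
/-- Marsden's identity, as an identity of polynomials in the dual variable. -/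
lemma marsden {t : ℕ → ℝ} (ht : Monotone t) (N d : ℕ) {x : ℝ} (hx : t d ≤ x) (hxN : x < t N) :
    ∑ i ∈ Finset.range N, C (bspline t d i x) * dualPoly t d i = (X - C x) ^ d := by
  induction d with
  | zero =>
    have h0 : ∀ i, bspline t 0 i x =
        (if t i ≤ x then (1 : ℝ) else 0) - (if t (i + 1) ≤ x then 1 else 0) := by
      intro i
      have := ht (Nat.le_succ i)
      simp only [bspline, Set.indicator, Set.mem_Ico]
      rcases le_or_gt (t (i + 1)) x with h | h
      · rw [if_neg (by simp [h]), if_pos (this.trans h), if_pos h]; ring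
      · rw [if_neg (not_le.2 h)]; simp [h]
    have h1 : ∀ i, dualPoly t 0 i = 1 := by
      intro i
      have he : Finset.Ioo i (i + 0 + 1) = ∅ := by ext k; simp
      rw [dualPoly, he, Finset.prod_empty]
    simp only [h1, mul_one, pow_zero]
    rw [← map_sum]
    simp only [h0]
    rw [Finset.sum_range_sub', if_pos hx, if_neg (not_le.2 hxN)]; simp
  | succ d ih =>
    have hx' : t d ≤ x := (ht (Nat.le_succ d)).trans hx
    specialize ih hx'
    -- the two halves of the recurrence, the second one shifted by one index
    set A : ℕ → ℝ[X] := fun i =>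
      C ((x - t i) / (t (i + d + 1) - t i) * bspline t d i x) * dualPoly t (d + 1) i
    set B : ℕ → ℝ[X] := fun i =>
      C ((t (i + d + 1) - x) / (t (i + d + 1) - t i) * bspline t d i x) *
        ((X - C (t i)) * dualPoly t d i)
    have hAB : ∀ i, C (bspline t (d + 1) i x) * dualPoly t (d + 1) i = A i + B (i + 1) := by
      intro i
      simp only [A, B, bspline, map_add, add_mul]
      congr 2
      · congr 3 <;> ring_nf
      · rw [dualPoly_succ_left]
    have hsum : ∀ i, A i + B i = C (bspline t d i x) * dualPoly t d i * (X - C x) := by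
      intro i
      rcases eq_or_ne (t (i + d + 1)) (t i) with h | h
      · have hz : bspline t d i x = 0 := by
          rcases lt_or_ge x (t i) with h' | h'
          · exact bspline_eq_zero_of_lt ht d i h'
          · exact bspline_eq_zero_of_ge ht d i (h ▸ h')
        simp [A, B, hz]
      · have h' : t (i + d + 1) - t i ≠ 0 := sub_ne_zero.2 h
        have e1 : (x - t i) / (t (i + d + 1) - t i) + (t (i + d + 1) - x) / (t (i + d + 1) - t i)
            = 1 := by field_simp; ring
        have e2 : (x - t i) / (t (i + d + 1) - t i) * t (i + d + 1)
            + (t (i + d + 1) - x) / (t (i + d + 1) - t i) * t i = x := by field_simp; ring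
        have e1' := congrArg (C : ℝ → ℝ[X]) e1
        have e2' := congrArg (C : ℝ → ℝ[X]) e2
        simp only [map_add, map_mul, map_one] at e1' e2'
        simp only [A, B, map_mul, dualPoly_succ_right]
        linear_combination (C (bspline t d i x) * dualPoly t d i) * (X * e1' - e2')
    simp only [hAB, Finset.sum_add_distrib]
    have hB0 : B 0 = 0 := by
      simp only [B]
      rw [bspline_eq_zero_of_ge ht d 0 (by simpa using hx)]; simp
    have hBN : B N = 0 := by
      simp only [B]
      rw [bspline_eq_zero_of_lt ht d N hxN]; simp
    have hshift : ∑ i ∈ Finset.range N, B (i + 1) = ∑ i ∈ Finset.range N, B i := by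
      have h1 := Finset.sum_range_succ B N
      have h2 := Finset.sum_range_succ' B N
      rw [hB0, add_zero] at h2
      rw [hBN, add_zero] at h1
      rw [← h1, ← h2]
    rw [hshift, ← Finset.sum_add_distrib]
    simp only [hsum]
    rw [← Finset.sum_mul, ih, pow_succ]

open Polynomial in
/-- A truncated power at a knot is a combination of B-splines: in Marsden's identity, expanded at
the knot `τ`, the B-splines that straddle `τ` have dual polynomials vanishing to the order of the
multiplicity of `τ`, so that the sum over the remaining ones to the right is the truncation. -/
lemma truncPow_mem_span {t : ℕ → ℝ} (ht : Monotone t) {p N : ℕ} {b τ : ℝ}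
    (hN : t N = b) (hlast : t (N + p) = b) {j m l : ℕ} (hj : ∀ k, j ≤ k → k < j + m → t k = τ)
    (hl : l < m) (hlp : l ≤ p) (hτ : t p ≤ τ) :
    truncPow b τ (p - l) ∈ Submodule.span ℝ {B | ∃ i < N, B = bspline t p i} := by
  classical
  set c : ℕ → ℝ := fun i => (taylor τ (dualPoly t p i)).coeff l
  have hc : ∀ i, t i < τ → τ < t (i + p + 1) → c i = 0 := by
    -- all copies of the knot `τ` are among the roots of the dual polynomial
    intro i h1 h2
    have hdvd : (X - C τ) ^ m ∣ dualPoly t p i := by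
      have hprod : ∏ k ∈ Finset.Ico j (j + m), (X - C (t k)) = (X - C τ) ^ m := by
        rw [Finset.prod_congr rfl (g := fun _ => X - C τ)]
        · simp
        · intro k hk
          rw [Finset.mem_Ico] at hk
          rw [hj k hk.1 hk.2]
      rw [← hprod]
      refine Finset.prod_dvd_prod_of_subset _ _ _ ?_
      intro k hk
      rw [Finset.mem_Ico] at hk
      have hk' := hj k hk.1 hk.2
      rw [Finset.mem_Ioo]
      exact ⟨ht.reflect_lt (by rw [hk']; exact h1), ht.reflect_lt (by rw [hk']; exact h2)⟩
    obtain ⟨q, hq⟩ := hdvd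
    have : taylor τ (dualPoly t p i) = X ^ m * taylor τ q := by
      rw [hq, taylor_mul, taylor_pow]; simp
    simp only [c, this]
    rw [coeff_X_pow_mul', if_neg (by omega)]
  -- the B-splines with `t i < τ` and a nonzero coefficient vanish on `[τ, ∞)`
  have key : ∀ x, ∑ i ∈ (Finset.range N).filter (fun i => τ ≤ t i), c i * bspline t p i x =
      (-1) ^ (p - l) * (p.choose l) * truncPow b τ (p - l) x := by
    intro x
    by_cases hx : τ ≤ x ∧ x < b
    · have hM := marsden ht N p (hτ.trans hx.1) (by rw [hN]; exact hx.2)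
      have hM' := congrArg (fun q => (taylor τ q).coeff l) hM
      simp only [map_sum, taylor_mul, taylor_C, finsetSum_coeff, coeff_C_mul, taylor_pow,
        map_sub, taylor_X] at hM'
      rw [Finset.sum_filter_of_ne]
      · rw [truncPow, if_pos hx]
        have e : (X + C τ - C x : ℝ[X]) = X + C (τ - x) := by rw [C_sub]; ring
        rw [e, coeff_X_add_C_pow] at hM'
        rw [Finset.sum_congr rfl (fun i _ => mul_comm _ _), hM',
          show τ - x = (-1) * (x - τ) by ring, mul_pow]
        ring
      · intro i _ hne
        by_contra h
        rw [not_le] at h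
        rcases lt_or_ge τ (t (i + p + 1)) with h2 | h2
        · exact hne (by rw [hc i h h2, zero_mul])
        · exact hne (by rw [bspline_eq_zero_of_ge ht p i (h2.trans hx.1), mul_zero])
    · rw [truncPow, if_neg hx, mul_zero]
      refine Finset.sum_eq_zero fun i hi => ?_
      rw [Finset.mem_filter, Finset.mem_range] at hi
      rw [not_and_or, not_le, not_lt] at hx
      rcases hx with hx | hx
      · rw [bspline_eq_zero_of_lt ht p i (hx.trans_le hi.2), mul_zero]
      · rw [bspline_eq_zero_of_ge ht p i, mul_zero]
        exact (ht (by omega : i + p + 1 ≤ N + p)).trans (hlast.le.trans hx)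
  have hne : ((-1) ^ (p - l) * (p.choose l) : ℝ) ≠ 0 := by
    refine mul_ne_zero (pow_ne_zero _ (by norm_num)) ?_
    exact_mod_cast (Nat.choose_pos hlp).ne'
  have hfun : truncPow b τ (p - l) = ((-1) ^ (p - l) * (p.choose l) : ℝ)⁻¹ •
      ∑ i ∈ (Finset.range N).filter (fun i => τ ≤ t i), c i • bspline t p i := by
    ext x
    simp only [Pi.smul_apply, Finset.sum_apply, smul_eq_mul]
    rw [key, inv_mul_cancel_left₀ hne]
  rw [hfun]
  refine Submodule.smul_mem _ _ (Submodule.sum_mem _ fun i hi => Submodule.smul_mem _ _ ?_)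
  rw [Finset.mem_filter, Finset.mem_range] at hi
  exact Submodule.subset_span ⟨i, hi.1, rfl⟩

/-! ### The knot vector -/

section Knots

variable {p n : ℕ} {ξ : ℕ → ℝ} {r : ℕ → ℕ}

/-- The points that divide `[a, b]` into `p` equal parts. -/
noncomputable def equiNode (p : ℕ) (a b : ℝ) (i : ℕ) : ℝ := a + (i : ℝ) / (p : ℝ) * (b - a)

lemma equiNode_zero (p : ℕ) (a b : ℝ) : equiNode p a b 0 = a := by simp [equiNode]

lemma equiNode_self {p : ℕ} (hp : 1 ≤ p) (a b : ℝ) : equiNode p a b p = b := by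
  have : (p : ℝ) ≠ 0 := by exact_mod_cast (by omega)
  rw [equiNode, div_self this]; ring

lemma equiNode_lt {p : ℕ} (hp : 1 ≤ p) {a b : ℝ} (hab : a < b) {i k : ℕ} (h : i < k) :
    equiNode p a b i < equiNode p a b k := by
  have : (0 : ℝ) < p := by exact_mod_cast hp
  have h2 : 0 < b - a := by linarith
  unfold equiNode
  gcongr

lemma equiNode_mono {p : ℕ} (hp : 1 ≤ p) {a b : ℝ} (hab : a < b) {i k : ℕ} (h : i ≤ k) :
    equiNode p a b i ≤ equiNode p a b k :=
  (strictMono_nat_of_lt_succ (f := equiNode p a b)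
    fun _ => equiNode_lt hp hab (Nat.lt_succ_self _)).monotone h

lemma IsOpenKnots.breakpoint_lt (h : IsOpenKnots p n ξ r) {i j : ℕ} (hij : i < j) (hj : j ≤ n) :
    ξ i < ξ j := by
  induction j, hij using Nat.le_induction with
  | base => exact h.lt_succ i (by omega)
  | succ k hk ih => exact (ih (by omega)).trans (h.lt_succ k (by omega))

lemma IsOpenKnots.breakpoint_le (h : IsOpenKnots p n ξ r) {i j : ℕ} (hij : i ≤ j) (hj : j ≤ n) :
    ξ i ≤ ξ j := by
  rcases hij.eq_or_lt with rfl | h'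
  · exact le_rfl
  · exact (h.breakpoint_lt h' hj).le

/-- The `i`-th of the points that divide the `j`-th element into `p` equal parts; `i = 0` is the
left end point. -/
noncomputable def subKnot (p : ℕ) (ξ : ℕ → ℝ) (j i : ℕ) : ℝ := equiNode p (ξ j) (ξ (j + 1)) i

lemma subKnot_zero (p : ℕ) (ξ : ℕ → ℝ) (j : ℕ) : subKnot p ξ j 0 = ξ j := equiNode_zero _ _ _

lemma IsOpenKnots.subKnot_lt_subKnot (h : IsOpenKnots p n ξ r) {j i k : ℕ} (hj : j < n)
    (hik : i < k) : subKnot p ξ j i < subKnot p ξ j k :=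
  equiNode_lt h.degree_pos (h.lt_succ j hj) hik

lemma IsOpenKnots.le_subKnot (h : IsOpenKnots p n ξ r) {j : ℕ} (i : ℕ) (hj : j < n) :
    ξ j ≤ subKnot p ξ j i :=
  (subKnot_zero p ξ j).symm.le.trans (equiNode_mono h.degree_pos (h.lt_succ j hj) (Nat.zero_le i))

lemma IsOpenKnots.subKnot_lt (h : IsOpenKnots p n ξ r) {j i : ℕ} (hj : j < n) (hi : i < p) :
    subKnot p ξ j i < ξ (j + 1) :=
  (h.subKnot_lt_subKnot hj hi).trans_eq (equiNode_self h.degree_pos _ _)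

/-- The knots of the half-open `j`-th element. -/
noncomputable def knotBlock (p : ℕ) (ξ : ℕ → ℝ) (r : ℕ → ℕ) (j : ℕ) : List ℝ :=
  List.replicate (r j) (ξ j) ++ (List.range (p - 1)).map (fun i => subKnot p ξ j (i + 1))

lemma knotList_eq (p n : ℕ) (ξ : ℕ → ℝ) (r : ℕ → ℕ) :
    knotList p n ξ r =
      (List.range n).flatMap (knotBlock p ξ r) ++ List.replicate (r n) (ξ n) := rfl

lemma IsOpenKnots.mem_knotBlock (h : IsOpenKnots p n ξ r) {j : ℕ} (hj : j < n) {x : ℝ}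
    (hx : x ∈ knotBlock p ξ r j) : ξ j ≤ x ∧ x < ξ (j + 1) := by
  rw [knotBlock, List.mem_append, List.mem_replicate, List.mem_map] at hx
  rcases hx with ⟨_, rfl⟩ | ⟨i, hi, rfl⟩
  · exact ⟨le_rfl, h.lt_succ j hj⟩
  · rw [List.mem_range] at hi
    exact ⟨h.le_subKnot _ hj, h.subKnot_lt hj (by omega)⟩

lemma IsOpenKnots.sorted_knotList (h : IsOpenKnots p n ξ r) :
    (knotList p n ξ r).Pairwise (· ≤ ·) := by
  rw [knotList_eq, List.pairwise_append, List.pairwise_flatMap]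
  refine ⟨⟨?_, ?_⟩, ?_, ?_⟩
  · intro j hj
    rw [List.mem_range] at hj
    rw [knotBlock, List.pairwise_append, List.pairwise_map]
    refine ⟨?_, ?_, ?_⟩
    · rw [List.pairwise_replicate]; exact Or.inr le_rfl
    · exact (List.pairwise_lt_range).imp
        (fun {a b} hab => (h.subKnot_lt_subKnot hj (by omega)).le)
    · intro a ha b hb
      rw [List.mem_replicate] at ha
      rw [List.mem_map] at hb
      obtain ⟨i, -, rfl⟩ := hb
      rw [ha.2]
      exact h.le_subKnot _ hj
  · refine List.Pairwise.imp_of_mem ?_ (List.pairwise_lt_range (n := n))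
    intro i j hi hj hij x hx y hy
    rw [List.mem_range] at hi hj
    exact (h.mem_knotBlock hi hx).2.le.trans
      ((h.breakpoint_le (by omega) hj.le).trans (h.mem_knotBlock hj hy).1)
  · rw [List.pairwise_replicate]; exact Or.inr le_rfl
  · intro x hx y hy
    rw [List.mem_flatMap] at hx
    obtain ⟨j, hj, hx⟩ := hx
    rw [List.mem_range] at hj
    rw [List.mem_replicate] at hy
    rw [hy.2]
    exact (h.mem_knotBlock hj hx).2.le.trans (h.breakpoint_le (by omega) le_rfl)

/-- The dimension of the spline space. -/
def knotCount (p n : ℕ) (r : ℕ → ℕ) : ℕ := ∑ j ∈ Finset.range n, (r j + (p - 1))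

lemma length_flatMap_knotBlock (p n : ℕ) (ξ : ℕ → ℝ) (r : ℕ → ℕ) :
    ((List.range n).flatMap (knotBlock p ξ r)).length = knotCount p n r := by
  induction n with
  | zero => simp [knotCount]
  | succ n ih =>
    rw [List.range_succ, List.flatMap_append, List.length_append, ih, knotCount, knotCount,
      Finset.sum_range_succ]
    simp [knotBlock]

lemma IsOpenKnots.length_knotList (h : IsOpenKnots p n ξ r) :
    (knotList p n ξ r).length = knotCount p n r + (p + 1) := by
  rw [knotList_eq, List.length_append, length_flatMap_knotBlock, List.length_replicate, h.last]

/-- The knot vector as a sequence, continued by the last knot. -/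
noncomputable def knotSeq (p n : ℕ) (ξ : ℕ → ℝ) (r : ℕ → ℕ) (k : ℕ) : ℝ :=
  (knotList p n ξ r).getD k (ξ n)

lemma IsOpenKnots.knotSeq_le (h : IsOpenKnots p n ξ r) {x : ℝ} (hx : x ∈ knotList p n ξ r) :
    x ≤ ξ n := by
  rw [knotList_eq, List.mem_append, List.mem_flatMap, List.mem_replicate] at hx
  rcases hx with ⟨j, hj, hx⟩ | ⟨_, rfl⟩
  · rw [List.mem_range] at hj
    exact (h.mem_knotBlock hj hx).2.le.trans (h.breakpoint_le (by omega) le_rfl)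
  · exact le_rfl

lemma IsOpenKnots.monotone_knotSeq (h : IsOpenKnots p n ξ r) : Monotone (knotSeq p n ξ r) := by
  intro i j hij
  unfold knotSeq
  rcases lt_or_ge j (knotList p n ξ r).length with hj | hj
  · rw [List.getD_eq_getElem _ _ hj, List.getD_eq_getElem _ _ (hij.trans_lt hj)]
    rcases hij.eq_or_lt with rfl | hij
    · exact le_rfl
    · exact (List.pairwise_iff_getElem.1 h.sorted_knotList) i j _ _ hij
  · rw [List.getD_eq_default _ _ hj]
    rcases lt_or_ge i (knotList p n ξ r).length with hi | hi
    · rw [List.getD_eq_getElem _ _ hi]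
      exact h.knotSeq_le (List.getElem_mem _)
    · rw [List.getD_eq_default _ _ hi]

lemma getD_append_replicate {α : Type*} (A B : List α) (m : ℕ) (τ d : α) {k : ℕ}
    (h1 : A.length ≤ k) (h2 : k < A.length + m) :
    (A ++ (List.replicate m τ ++ B)).getD k d = τ := by
  rw [List.getD_append_right _ _ _ _ h1, List.getD_append _ _ _ _ (by simp; omega),
    List.getD_replicate]
  omega

lemma knotSeq_last (h : IsOpenKnots p n ξ r) {k : ℕ} (hk : knotCount p n r ≤ k) :
    knotSeq p n ξ r k = ξ n := by
  rcases lt_or_ge k (knotCount p n r + (p + 1)) with h' | h'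
  · rw [knotSeq, knotList_eq, ← List.append_nil (List.replicate _ _)]
    apply getD_append_replicate
    · rwa [length_flatMap_knotBlock]
    · rwa [length_flatMap_knotBlock, h.last]
  · rw [knotSeq, List.getD_eq_default]
    rwa [h.length_knotList]

lemma exists_knotSeq_breakpoint {j : ℕ} (hj : j < n) :
    ∃ j₀, ∀ k, j₀ ≤ k → k < j₀ + r j → knotSeq p n ξ r k = ξ j := by
  obtain ⟨A, B, hAB⟩ := List.append_of_mem (List.mem_range.2 hj)
  refine ⟨(A.flatMap (knotBlock p ξ r)).length, fun k h1 h2 => ?_⟩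
  rw [knotSeq, knotList_eq, hAB, List.flatMap_append, List.flatMap_cons, knotBlock]
  simp only [List.append_assoc]
  exact getD_append_replicate _ _ _ _ _ h1 h2

lemma exists_knotSeq_subKnot {j i : ℕ} (hj : j < n) (hi : i < p - 1) :
    ∃ j₀, ∀ k, j₀ ≤ k → k < j₀ + 1 → knotSeq p n ξ r k = subKnot p ξ j (i + 1) := by
  obtain ⟨A, B, hAB⟩ := List.append_of_mem (List.mem_range.2 hj)
  obtain ⟨A', B', hAB'⟩ := List.append_of_mem (List.mem_range.2 hi)
  refine ⟨(A.flatMap (knotBlock p ξ r) ++ List.replicate (r j) (ξ j) ++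
    A'.map (fun i => subKnot p ξ j (i + 1))).length, fun k h1 h2 => ?_⟩
  have := getD_append_replicate (A.flatMap (knotBlock p ξ r) ++ List.replicate (r j) (ξ j) ++
    A'.map (fun i => subKnot p ξ j (i + 1))) (B'.map (fun i => subKnot p ξ j (i + 1)) ++
      B.flatMap (knotBlock p ξ r) ++ List.replicate (r n) (ξ n)) 1
      (subKnot p ξ j (i + 1)) (ξ n) h1 h2
  rw [← this, knotSeq, knotList_eq, hAB, List.flatMap_append, List.flatMap_cons, knotBlock, hAB']
  simp

/-- The spline space is spanned by the B-splines on the extended knot sequence. -/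
lemma IsOpenKnots.splineSpace_eq (h : IsOpenKnots p n ξ r) : splineSpace p n ξ r =
    Submodule.span ℝ {B | ∃ i < knotCount p n r, B = bspline (knotSeq p n ξ r) p i} := by
  have hlen : (knotList p n ξ r).length - (p + 1) = knotCount p n r := by
    rw [h.length_knotList]; omega
  rw [splineSpace, hlen]
  congr 1
  ext B
  simp only [Set.mem_ofPred_eq]
  refine exists_congr fun i => and_congr_right fun hi => ?_
  rw [bspline_congr (t' := knotSeq p n ξ r)]
  intro k hk
  have hk' : k < (knotList p n ξ r).length := by rw [h.length_knotList]; omega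
  rw [knotSeq, List.getD_eq_getElem _ _ hk', List.getD_eq_getElem _ _ hk']

lemma IsOpenKnots.knotSeq_degree_le (h : IsOpenKnots p n ξ r) : knotSeq p n ξ r p ≤ ξ 0 := by
  obtain ⟨j₀, hj₀⟩ := exists_knotSeq_breakpoint (p := p) (ξ := ξ) (r := r) h.elements_pos
  rw [← hj₀ (j₀ + p) (by omega) (by rw [h.first]; omega)]
  exact h.monotone_knotSeq (by omega)

lemma IsOpenKnots.truncPow_breakpoint_mem (h : IsOpenKnots p n ξ r) {j l : ℕ} (hj : j < n)
    (hl : l < r j) (hlp : l ≤ p) : truncPow (ξ n) (ξ j) (p - l) ∈ splineSpace p n ξ r := by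
  obtain ⟨j₀, hj₀⟩ := exists_knotSeq_breakpoint (p := p) (ξ := ξ) (r := r) hj
  rw [h.splineSpace_eq]
  exact truncPow_mem_span h.monotone_knotSeq (knotSeq_last h le_rfl) (knotSeq_last h (by omega))
    hj₀ hl hlp (h.knotSeq_degree_le.trans (h.breakpoint_le (by omega) hj.le))

lemma IsOpenKnots.truncPow_subKnot_mem (h : IsOpenKnots p n ξ r) {j i : ℕ} (hj : j < n)
    (hi : i < p - 1) : truncPow (ξ n) (subKnot p ξ j (i + 1)) p ∈ splineSpace p n ξ r := by
  obtain ⟨j₀, hj₀⟩ := exists_knotSeq_subKnot (p := p) (ξ := ξ) (r := r) hj hi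
  rw [h.splineSpace_eq]
  exact truncPow_mem_span (l := 0) h.monotone_knotSeq (knotSeq_last h le_rfl)
    (knotSeq_last h (by omega)) hj₀ zero_lt_one (by omega)
    (h.knotSeq_degree_le.trans ((h.breakpoint_le (by omega) hj.le).trans (h.le_subKnot _ hj)))

/-! ### The spline space as a span of truncated powers -/

/-- The truncated powers at the knots, with exponents `p, p - 1, ...` up to the multiplicity. -/
noncomputable def truncFamily (p n : ℕ) (ξ : ℕ → ℝ) (r : ℕ → ℕ)
    (a : Σ j : Fin n, Fin (r j) ⊕ Fin (p - 1)) : ℝ → ℝ :=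
  match a with
  | ⟨j, Sum.inl l⟩ => truncPow (ξ n) (ξ j) (p - l)
  | ⟨j, Sum.inr i⟩ => truncPow (ξ n) (subKnot p ξ j (i + 1)) p

lemma IsOpenKnots.le_of_lt_mult (h : IsOpenKnots p n ξ r) {j l : ℕ} (hj : j < n) (hl : l < r j) :
    l ≤ p := by
  rcases Nat.eq_zero_or_pos j with rfl | hj0
  · have := h.first; omega
  · have := h.interior j hj0 hj; omega

lemma IsOpenKnots.truncFamily_mem (h : IsOpenKnots p n ξ r)
    (a : Σ j : Fin n, Fin (r j) ⊕ Fin (p - 1)) : truncFamily p n ξ r a ∈ splineSpace p n ξ r := by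
  obtain ⟨j, l | i⟩ := a
  · exact h.truncPow_breakpoint_mem j.2 l.2 (h.le_of_lt_mult j.2 l.2)
  · exact h.truncPow_subKnot_mem j.2 i.2

/-- Truncated powers with different knots or exponents are linearly independent: on a
right neighbourhood of the smallest knot with a nonzero coefficient only the powers at this
knot are seen. -/
lemma linearIndependent_truncPow {ι : Type*} [Fintype ι] (b : ℝ) (τ : ι → ℝ) (e : ι → ℕ)
    (hτ : ∀ a, τ a < b) (hinj : ∀ a a', τ a = τ a' → e a = e a' → a = a') :
    LinearIndependent ℝ (fun a => truncPow b (τ a) (e a)) := by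
  classical
  rw [Fintype.linearIndependent_iff]
  intro c hc
  by_contra! hne
  obtain ⟨a₁, ha₁⟩ := hne
  obtain ⟨a₀, ha₀, hmin⟩ := Finset.exists_min_image (Finset.univ.filter fun a => c a ≠ 0) τ
    ⟨a₁, by simpa using ha₁⟩
  simp only [Finset.mem_filter, Finset.mem_univ, true_and] at ha₀ hmin
  have hev : ∀ᶠ x in 𝓝[>] (τ a₀), ∀ a, (τ a₀ < τ a → x < τ a) := by
    rw [eventually_all]
    intro a
    by_cases h : τ a₀ < τ a
    · filter_upwards [Ioo_mem_nhdsGT h] with x hx _ using hx.2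
    · exact Eventually.of_forall fun x h' => absurd h' h
  set q : Polynomial ℝ := ∑ a ∈ Finset.univ.filter (fun a => τ a = τ a₀),
    Polynomial.C (c a) * Polynomial.X ^ (e a)
  have hq : ∀ᶠ x in 𝓝[>] (τ a₀), q.eval (x - τ a₀) = 0 := by
    filter_upwards [hev, Ioo_mem_nhdsGT (hτ a₀)] with x hx hx'
    have := congrFun hc x
    simp only [Finset.sum_apply, Pi.smul_apply, smul_eq_mul, Pi.zero_apply] at this
    rw [← this]
    simp only [q, Polynomial.eval_finsetSum, Polynomial.eval_mul, Polynomial.eval_C,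
      Polynomial.eval_pow, Polynomial.eval_X]
    rw [Finset.sum_filter]
    refine Finset.sum_congr rfl fun a _ => ?_
    by_cases hca : c a = 0
    · simp [hca]
    · rcases (hmin a hca).eq_or_lt with h | h
      · rw [if_pos h.symm, truncPow, if_pos ⟨by rw [← h]; exact hx'.1.le, hx'.2⟩, h]
      · rw [if_neg h.ne', truncPow, if_neg (fun h' => absurd h'.1 (not_le.2 (hx a h))), mul_zero]
  have hq0 : q = 0 := by
    apply Polynomial.eq_zero_of_infinite_isRoot
    have hset : {x | q.eval (x - τ a₀) = 0} ∈ 𝓝[>] (τ a₀) := hq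
    obtain ⟨y, hy, hsub⟩ := mem_nhdsGT_iff_exists_Ioo_subset.1 hset
    have hinf : {x | q.eval (x - τ a₀) = 0}.Infinite := (Set.Ioo_infinite hy).mono hsub
    refine (hinf.image (f := fun x => x - τ a₀) (sub_left_injective.injOn)).mono ?_
    rintro _ ⟨x, hx, rfl⟩
    exact hx
  have hcoef : q.coeff (e a₀) = c a₀ := by
    simp only [q, Polynomial.finsetSum_coeff, Polynomial.coeff_C_mul, Polynomial.coeff_X_pow]
    rw [Finset.sum_eq_single a₀]
    · simp
    · intro a ha hne
      simp only [Finset.mem_filter, Finset.mem_univ, true_and] at ha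
      rw [if_neg (fun h => hne (hinj a a₀ ha h.symm)), mul_zero]
    · intro h; simp at h
  rw [hq0, Polynomial.coeff_zero] at hcoef
  exact ha₀ hcoef.symm

lemma IsOpenKnots.linearIndependent_truncFamily (h : IsOpenKnots p n ξ r) :
    LinearIndependent ℝ (truncFamily p n ξ r) := by
  have hsub : ∀ {j j' : ℕ} {i i' : ℕ}, j < n → j' < n → i < p → i' < p →
      subKnot p ξ j i = subKnot p ξ j' i' → j = j' ∧ i = i' := by
    intro j j' i i' hj hj' hi hi' heq
    have key : ∀ {j j' i i' : ℕ}, j' < n → i < p → j < j' →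
        subKnot p ξ j i < subKnot p ξ j' i' := fun hj' hi hlt =>
      (h.subKnot_lt (by omega) hi).trans_le
        ((h.breakpoint_le (by omega) hj'.le).trans (h.le_subKnot _ hj'))
    rcases lt_trichotomy j j' with hlt | rfl | hlt
    · exact absurd heq (key hj' hi hlt).ne
    · refine ⟨rfl, ?_⟩
      rcases lt_trichotomy i i' with h' | h' | h'
      · exact absurd heq (h.subKnot_lt_subKnot hj h').ne
      · exact h'
      · exact absurd heq (h.subKnot_lt_subKnot hj h').ne'
    · exact absurd heq (key hj hi' hlt).ne'
  let τ : (Σ j : Fin n, Fin (r j) ⊕ Fin (p - 1)) → ℝ := fun a =>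
    subKnot p ξ a.1 (Sum.elim (fun _ => 0) (fun i : Fin (p - 1) => (i : ℕ) + 1) a.2)
  let e : (Σ j : Fin n, Fin (r j) ⊕ Fin (p - 1)) → ℕ := fun a =>
    Sum.elim (fun l : Fin (r a.1) => p - (l : ℕ)) (fun _ => p) a.2
  have hlt : ∀ a : (Σ j : Fin n, Fin (r j) ⊕ Fin (p - 1)),
      Sum.elim (fun _ => 0) (fun i : Fin (p - 1) => (i : ℕ) + 1) a.2 < p := by
    have := h.degree_pos
    rintro ⟨j, l | i⟩
    · simpa using Nat.lt_of_lt_of_le Nat.zero_lt_one this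
    · have := i.2; simp only [Sum.elim_inr]; omega
  have hfam : truncFamily p n ξ r = fun a => truncPow (ξ n) (τ a) (e a) := by
    funext a
    obtain ⟨j, l | i⟩ := a
    · simp [truncFamily, τ, e, subKnot_zero]
    · simp [truncFamily, τ, e]
  rw [hfam]
  apply linearIndependent_truncPow
  · intro a
    exact (h.subKnot_lt a.1.2 (hlt a)).trans_le (h.breakpoint_le (by have := a.1.2; omega) le_rfl)
  · intro a a' h1 h2
    obtain ⟨h3, h4⟩ := hsub a.1.2 a'.1.2 (hlt a) (hlt a') h1
    obtain ⟨j, x⟩ := a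
    obtain ⟨j', x'⟩ := a'
    obtain rfl : j = j' := Fin.ext h3
    rcases x with l | i <;> rcases x' with l' | i'
    · have e1 := h.le_of_lt_mult j.2 l.2
      have e2 := h.le_of_lt_mult j.2 l'.2
      simp only [e, Sum.elim_inl] at h2
      congr 2
      exact Fin.ext (by omega)
    · simp at h4
    · simp at h4
    · simp only [Sum.elim_inr] at h4
      congr 2
      exact Fin.ext (by omega)

/-- The Curry–Schoenberg description of the spline space, by a dimension count: there are
as many truncated powers as B-splines. -/
lemma IsOpenKnots.splineSpace_eq_span_truncFamily (h : IsOpenKnots p n ξ r) :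
    splineSpace p n ξ r = Submodule.span ℝ (Set.range (truncFamily p n ξ r)) := by
  classical
  have hspan : splineSpace p n ξ r = Submodule.span ℝ
      (((Finset.range (knotCount p n r)).image (bspline (knotSeq p n ξ r) p) :
        Finset (ℝ → ℝ)) : Set (ℝ → ℝ)) := by
    rw [h.splineSpace_eq]
    congr 1
    ext B
    simp [eq_comm]
  have hfin : FiniteDimensional ℝ (splineSpace p n ξ r) := by
    rw [hspan]; exact FiniteDimensional.span_finset ℝ _
  have hle : Module.finrank ℝ (splineSpace p n ξ r) ≤ knotCount p n r := by
    rw [hspan]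
    refine (finrank_span_finset_le_card _).trans (Finset.card_image_le.trans ?_)
    rw [Finset.card_range]
  symm
  apply Submodule.eq_of_le_of_finrank_le
  · rw [Submodule.span_le]
    rintro _ ⟨a, rfl⟩
    exact h.truncFamily_mem a
  · rw [finrank_span_eq_card h.linearIndependent_truncFamily]
    refine hle.trans (le_of_eq ?_)
    simp only [Fintype.card_sigma, Fintype.card_sum, Fintype.card_fin, knotCount]
    rw [Finset.sum_range]

end Knots

/-! ### Derivative chains -/

/-- Two functions with the same value and derivative at `a` glue to a differentiable function. -/
lemma hasDerivAt_ite_lt {f g : ℝ → ℝ} {a d : ℝ} (hfg : f a = g a) (hf : HasDerivAt f d a)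
    (hg : HasDerivAt g d a) : HasDerivAt (fun x => if x < a then f x else g x) d a := by
  have h1 : HasDerivWithinAt (fun x => if x < a then f x else g x) d (Set.Iic a) a := by
    refine hf.hasDerivWithinAt.congr ?_ ?_
    · intro x hx
      rcases (Set.mem_Iic.1 hx).lt_or_eq with h | rfl
      · simp [h]
      · simp [hfg]
    · simp [hfg]
  have h2 : HasDerivWithinAt (fun x => if x < a then f x else g x) d (Set.Ici a) a := by
    refine hg.hasDerivWithinAt.congr ?_ ?_
    · intro x hx
      simp [not_lt.2 (Set.mem_Ici.1 hx)]
    · simp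
  have := h1.union h2
  rwa [Set.Iic_union_Ici, hasDerivWithinAt_univ] at this

lemma iteratedDeriv_chain {f : ℕ → ℝ → ℝ} {m : ℕ}
    (hf : ∀ k < m, ∀ x, HasDerivAt (f k) (f (k + 1) x) x) {l : ℕ} (hl : l ≤ m) :
    iteratedDeriv l (f 0) = f l := by
  induction l with
  | zero => simp
  | succ l ih =>
    rw [iteratedDeriv_succ, ih (by omega)]
    ext x
    exact (hf l (by omega) x).deriv

lemma contDiff_chain {f : ℕ → ℝ → ℝ} {m : ℕ}
    (hf : ∀ k < m, ∀ x, HasDerivAt (f k) (f (k + 1) x) x) (hc : Continuous (f m)) :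
    ContDiff ℝ m (f 0) := by
  rw [contDiff_nat_iff_iteratedDeriv]
  refine ⟨fun l hl => ?_, fun l hl => ?_⟩
  · rw [iteratedDeriv_chain hf hl]
    rcases hl.lt_or_eq with h | rfl
    · exact continuous_iff_continuousAt.2 fun x => (hf l h x).continuousAt
    · exact hc
  · rw [iteratedDeriv_chain hf hl.le]
    exact fun x => (hf l hl x).differentiableAt

lemma continuous_chain {f : ℕ → ℝ → ℝ} {m : ℕ}
    (hf : ∀ k < m, ∀ x, HasDerivAt (f k) (f (k + 1) x) x) (hc : Continuous (f m)) {l : ℕ}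
    (hl : l ≤ m) : Continuous (f l) := by
  rcases hl.lt_or_eq with h | rfl
  · exact continuous_iff_continuousAt.2 fun x => (hf l h x).continuousAt
  · exact hc

/-- One-sided limits of derivatives, read off from a chain that represents the function on one
side only. -/
lemma tendsto_iteratedDeriv_nhdsGT {f : ℕ → ℝ → ℝ} {m : ℕ} {s : ℝ → ℝ} {a b : ℝ} (hab : a < b)
    (hf : ∀ k < m, ∀ x, HasDerivAt (f k) (f (k + 1) x) x) (hc : Continuous (f m))
    (hs : Set.EqOn s (f 0) (Set.Ioo a b)) {l : ℕ} (hl : l ≤ m) :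
    Tendsto (iteratedDeriv l s) (𝓝[>] a) (𝓝 (f l a)) := by
  have h1 : Tendsto (f l) (𝓝[>] a) (𝓝 (f l a)) :=
    ((continuous_chain hf hc hl).tendsto a).mono_left nhdsWithin_le_nhds
  refine h1.congr' ?_
  filter_upwards [Ioo_mem_nhdsGT hab] with x hx
  have : s =ᶠ[𝓝 x] f 0 := hs.eventuallyEq_of_mem (isOpen_Ioo.mem_nhds hx)
  rw [this.iteratedDeriv_eq, iteratedDeriv_chain hf hl]

lemma tendsto_iteratedDeriv_nhdsLT {f : ℕ → ℝ → ℝ} {m : ℕ} {s : ℝ → ℝ} {a b : ℝ} (hab : a < b)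
    (hf : ∀ k < m, ∀ x, HasDerivAt (f k) (f (k + 1) x) x) (hc : Continuous (f m))
    (hs : Set.EqOn s (f 0) (Set.Ioo a b)) {l : ℕ} (hl : l ≤ m) :
    Tendsto (iteratedDeriv l s) (𝓝[<] b) (𝓝 (f l b)) := by
  have h1 : Tendsto (f l) (𝓝[<] b) (𝓝 (f l b)) :=
    ((continuous_chain hf hc hl).tendsto b).mono_left nhdsWithin_le_nhds
  refine h1.congr' ?_
  filter_upwards [Ioo_mem_nhdsLT hab] with x hx
  have : s =ᶠ[𝓝 x] f 0 := hs.eventuallyEq_of_mem (isOpen_Ioo.mem_nhds hx)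
  rw [this.iteratedDeriv_eq, iteratedDeriv_chain hf hl]

lemma continuousAt_iteratedDeriv {k : ℕ} {s : ℝ → ℝ} {x : ℝ} (hs : ContDiffAt ℝ k s x) {l : ℕ}
    (hl : l ≤ k) : ContinuousAt (iteratedDeriv l s) x := by
  induction l generalizing k s with
  | zero => simpa using hs.continuousAt
  | succ l ih =>
    obtain ⟨k, rfl⟩ : ∃ k', k = k' + 1 := ⟨k - 1, by omega⟩
    rw [iteratedDeriv_succ']
    refine ih (k := k) ?_ (by omega)
    exact ContDiffAt.derivWithin hs (by norm_cast)

/-! ### Splines on one element -/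

/-- The truncated power `x_+^e`, equal to `1` at `x = 0` if `e = 0`. -/
noncomputable def plusPow (e : ℕ) (x : ℝ) : ℝ := if x < 0 then 0 else x ^ e

lemma plusPow_of_nonneg {e : ℕ} {x : ℝ} (hx : 0 ≤ x) : plusPow e x = x ^ e :=
  if_neg (not_lt.2 hx)

lemma plusPow_of_neg {e : ℕ} {x : ℝ} (hx : x < 0) : plusPow e x = 0 := if_pos hx

lemma plusPow_of_nonpos {e : ℕ} (he : e ≠ 0) {x : ℝ} (hx : x ≤ 0) : plusPow e x = 0 := by
  rcases hx.lt_or_eq with h | rfl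
  · exact plusPow_of_neg h
  · simp [plusPow, he]

lemma hasDerivAt_plusPow {e : ℕ} (x : ℝ) (h : e ≠ 0 ∨ x ≠ 0) :
    HasDerivAt (plusPow (e + 1)) ((e + 1) * plusPow e x) x := by
  rcases lt_trichotomy x 0 with hx | rfl | hx
  · rw [plusPow_of_neg hx, mul_zero]
    refine (hasDerivAt_const x (0 : ℝ)).congr_of_eventuallyEq ?_
    filter_upwards [gt_mem_nhds hx] with y hy using plusPow_of_neg hy
  · have he : e ≠ 0 := by simpa using h
    refine hasDerivAt_ite_lt (f := fun _ => 0) (g := fun x => x ^ (e + 1)) (by simp) ?_ ?_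
    · rw [plusPow_of_nonpos he le_rfl, mul_zero]; exact hasDerivAt_const _ _
    · rw [plusPow_of_nonneg le_rfl]; simpa using hasDerivAt_pow (e + 1) (0 : ℝ)
  · rw [plusPow_of_nonneg hx.le]
    have := hasDerivAt_pow (e + 1) x
    simp only [Nat.add_sub_cancel] at this
    push_cast at this
    refine this.congr_of_eventuallyEq ?_
    filter_upwards [lt_mem_nhds hx] with y hy using plusPow_of_nonneg hy.le

lemma continuous_plusPow (e : ℕ) : Continuous (plusPow (e + 1)) := by
  have : plusPow (e + 1) = fun x => (max x 0) ^ (e + 1) := by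
    ext x
    rcases le_or_gt 0 x with h | h
    · rw [plusPow_of_nonneg h, max_eq_left h]
    · rw [plusPow_of_neg h, max_eq_right h.le]; simp
  rw [this]
  fun_prop

lemma hasDerivWithinAt_plusPow (e : ℕ) (x : ℝ) :
    HasDerivWithinAt (plusPow (e + 1)) ((e + 1) * plusPow e x) (Set.Ioi x) x := by
  by_cases h : e ≠ 0 ∨ x ≠ 0
  · exact (hasDerivAt_plusPow x h).hasDerivWithinAt
  · push Not at h
    obtain ⟨rfl, rfl⟩ := h
    have := (hasDerivAt_id (0 : ℝ)).hasDerivWithinAt (s := Set.Ioi 0)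
    rw [plusPow_of_nonneg le_rfl]
    simp only [CharP.cast_eq_zero, zero_add, pow_zero, mul_one]
    refine this.congr ?_ ?_
    · intro y hy; rw [plusPow_of_nonneg (le_of_lt hy)]; simp
    · rw [plusPow_of_nonneg le_rfl]; simp

lemma contDiff_plusPow (e : ℕ) : ContDiff ℝ e (plusPow (e + 1)) := by
  induction e with
  | zero =>
    have := continuous_plusPow 0
    simpa using this
  | succ e ih =>
    have hd : deriv (plusPow (e + 1 + 1)) = fun x => ((e + 1 : ℕ) + 1 : ℝ) * plusPow (e + 1) x := by
      ext x; exact (hasDerivAt_plusPow x (Or.inl (by omega))).deriv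
    push_cast
    rw [contDiff_succ_iff_deriv]
    refine ⟨fun x => (hasDerivAt_plusPow x (Or.inl (by omega))).differentiableAt, by simp, ?_⟩
    rw [hd]
    exact contDiff_const.mul ih

/-- The `l`-th derivative of the spline of degree `p` with nodes `τ`, in terms of the
coefficients `α` of the powers at `τ 0` and `c` of the truncated powers. -/
noncomputable def locSpline (p : ℕ) (τ α c : ℕ → ℝ) (l : ℕ) (x : ℝ) : ℝ :=
  ∑ k ∈ Finset.range p, α k * (k.descFactorial l * (x - τ 0) ^ (k - l)) +
    ∑ i ∈ Finset.range p, c i * (p.descFactorial l * plusPow (p - l) (x - τ i))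

lemma locSpline_zero (p : ℕ) (τ α c : ℕ → ℝ) (x : ℝ) :
    locSpline p τ α c 0 x = ∑ k ∈ Finset.range p, α k * (x - τ 0) ^ k +
      ∑ i ∈ Finset.range p, c i * plusPow p (x - τ i) := by
  simp [locSpline]

lemma locSpline_add (p : ℕ) (τ α c α' c' : ℕ → ℝ) (l : ℕ) (x : ℝ) :
    locSpline p τ (α + α') (c + c') l x = locSpline p τ α c l x + locSpline p τ α' c' l x := by
  simp only [locSpline, Pi.add_apply, add_mul, Finset.sum_add_distrib]; ring

lemma locSpline_smul (p : ℕ) (τ α c : ℕ → ℝ) (l : ℕ) (y x : ℝ) :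
    locSpline p τ (y • α) (y • c) l x = y * locSpline p τ α c l x := by
  simp only [locSpline, Pi.smul_apply, smul_eq_mul, mul_assoc, mul_add, Finset.mul_sum]

lemma hasDerivAt_desc_pow (k l : ℕ) (a x : ℝ) :
    HasDerivAt (fun x : ℝ => (k.descFactorial l : ℝ) * (x - a) ^ (k - l))
      (k.descFactorial (l + 1) * (x - a) ^ (k - (l + 1))) x := by
  have h := (((hasDerivAt_id x).sub_const a).pow (k - l)).const_mul (k.descFactorial l : ℝ)
  refine h.congr_deriv ?_
  rw [Nat.descFactorial_succ, Nat.sub_sub]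
  push_cast
  simp only [id]
  ring

lemma locSpline_hasDerivWithinAt {p l : ℕ} (hl : l < p) (τ α c : ℕ → ℝ) (x : ℝ) :
    HasDerivWithinAt (locSpline p τ α c l) (locSpline p τ α c (l + 1) x) (Set.Ioi x) x := by
  unfold locSpline
  refine HasDerivWithinAt.add ?_ ?_
  · refine HasDerivWithinAt.fun_sum fun k _ => ?_
    exact ((hasDerivAt_desc_pow k l (τ 0) x).const_mul (α k)).hasDerivWithinAt
  · refine HasDerivWithinAt.fun_sum fun i _ => ?_
    obtain ⟨e, he⟩ : ∃ e, p - l = e + 1 := ⟨p - l - 1, by omega⟩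
    have hsub : HasDerivWithinAt (fun x : ℝ => x - τ i) 1 (Set.Ioi x) x :=
      ((hasDerivAt_id x).sub_const (τ i)).hasDerivWithinAt
    have h := (((hasDerivWithinAt_plusPow e (x - τ i)).comp x hsub
      (fun y hy => sub_lt_sub_right hy (τ i))).const_mul (p.descFactorial l : ℝ)).const_mul (c i)
    rw [he]
    refine h.congr_deriv ?_
    rw [Nat.descFactorial_succ, he, show p - (l + 1) = e by omega]
    push_cast
    ring

lemma locSpline_hasDerivAt {p l : ℕ} (hl : l < p - 1) (τ α c : ℕ → ℝ) (x : ℝ) :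
    HasDerivAt (locSpline p τ α c l) (locSpline p τ α c (l + 1) x) x := by
  unfold locSpline
  refine HasDerivAt.add ?_ ?_
  · refine HasDerivAt.fun_sum fun k _ => ?_
    exact (hasDerivAt_desc_pow k l (τ 0) x).const_mul (α k)
  · refine HasDerivAt.fun_sum fun i _ => ?_
    obtain ⟨e, he⟩ : ∃ e, p - l = e + 1 + 1 := ⟨p - l - 2, by omega⟩
    have hsub : HasDerivAt (fun x : ℝ => x - τ i) 1 x := (hasDerivAt_id x).sub_const (τ i)
    have h := (((hasDerivAt_plusPow (e := e + 1) (x - τ i) (Or.inl (by omega))).comp x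
      hsub).const_mul (p.descFactorial l : ℝ)).const_mul (c i)
    rw [he]
    refine h.congr_deriv ?_
    rw [Nat.descFactorial_succ, he, show p - (l + 1) = e + 1 by omega]
    push_cast
    ring

lemma continuous_locSpline {p l : ℕ} (hl : l < p) (τ α c : ℕ → ℝ) :
    Continuous (locSpline p τ α c l) := by
  obtain ⟨e, he⟩ : ∃ e, p - l = e + 1 := ⟨p - l - 1, by omega⟩
  have := continuous_plusPow e
  unfold locSpline
  rw [he]
  fun_prop

/-- At the left end point the derivatives of a local spline are read off from its polynomial
part. -/
lemma locSpline_left {p l : ℕ} (hl : l < p) {τ : ℕ → ℝ} (hτ : ∀ i < p, τ 0 ≤ τ i) (α c : ℕ → ℝ) :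
    locSpline p τ α c l (τ 0) = α l * l.factorial := by
  unfold locSpline
  rw [Finset.sum_eq_single l, Finset.sum_eq_zero, add_zero]
  · simp [Nat.descFactorial_self]
  · intro i hi
    rw [plusPow_of_nonpos (by omega) (sub_nonpos.2 (hτ i (Finset.mem_range.1 hi)))]; simp
  · intro k _ hk
    rcases lt_or_gt_of_ne hk with h | h
    · simp [Nat.descFactorial_of_lt h]
    · simp [Nat.sub_ne_zero_of_lt h]
  · intro h; exact absurd (Finset.mem_range.2 hl) h

/-! ### Spline space and piecewise polynomials -/

section PieceSpace

variable {p n : ℕ} {ξ : ℕ → ℝ} {r : ℕ → ℕ}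

/-- The piecewise polynomials described by the knots: zero outside `[ξ 0, ξ n)`, on each element a
spline of degree `p` with simple knots at the interior subdivision points, and of class
`C^{p - r j}` at the interior breakpoints. -/
noncomputable def pieceSpace (p n : ℕ) (ξ : ℕ → ℝ) (r : ℕ → ℕ) : Submodule ℝ (ℝ → ℝ) where
  carrier := {s | (∀ x, ¬ (ξ 0 ≤ x ∧ x < ξ n) → s x = 0) ∧
    (∀ j < n, ∃ α c : ℕ → ℝ, ∀ x ∈ Set.Ico (ξ j) (ξ (j + 1)),
      s x = locSpline p (subKnot p ξ j) α c 0 x) ∧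
    ∀ j, 0 < j → j < n → ContDiffAt ℝ ((p - r j : ℕ) : WithTop ℕ∞) s (ξ j)}
  zero_mem' := by
    refine ⟨fun x _ => rfl, fun j _ => ⟨0, 0, fun x _ => by simp [locSpline]⟩, fun j _ _ => ?_⟩
    exact contDiffAt_const
  add_mem' := by
    rintro s s' ⟨h1, h2, h3⟩ ⟨h1', h2', h3'⟩
    refine ⟨fun x hx => by simp [h1 x hx, h1' x hx], fun j hj => ?_, fun j h0 hj => ?_⟩
    · obtain ⟨α, c, h⟩ := h2 j hj
      obtain ⟨α', c', h'⟩ := h2' j hj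
      refine ⟨α + α', c + c', fun x hx => ?_⟩
      rw [locSpline_add, Pi.add_apply, h x hx, h' x hx]
    · exact (h3 j h0 hj).add (h3' j h0 hj)
  smul_mem' := by
    rintro y s ⟨h1, h2, h3⟩
    refine ⟨fun x hx => by simp [h1 x hx], fun j hj => ?_, fun j h0 hj => ?_⟩
    · obtain ⟨α, c, h⟩ := h2 j hj
      refine ⟨y • α, y • c, fun x hx => ?_⟩
      rw [locSpline_smul, Pi.smul_apply, h x hx, smul_eq_mul]
    · exact (h3 j h0 hj).const_smul y

lemma mem_pieceSpace {s : ℝ → ℝ} : s ∈ pieceSpace p n ξ r ↔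
    (∀ x, ¬ (ξ 0 ≤ x ∧ x < ξ n) → s x = 0) ∧
    (∀ j < n, ∃ α c : ℕ → ℝ, ∀ x ∈ Set.Ico (ξ j) (ξ (j + 1)),
      s x = locSpline p (subKnot p ξ j) α c 0 x) ∧
    ∀ j, 0 < j → j < n → ContDiffAt ℝ ((p - r j : ℕ) : WithTop ℕ∞) s (ξ j) := Iff.rfl

lemma sum_range_single_mul {p i : ℕ} (hi : i < p) (y : ℝ) (f : ℕ → ℝ) :
    ∑ k ∈ Finset.range p, (Pi.single i y : ℕ → ℝ) k * f k = y * f i := by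
  rw [Finset.sum_eq_single_of_mem i (Finset.mem_range.2 hi), Pi.single_eq_same]
  intro k _ hk
  rw [Pi.single_eq_of_ne hk, zero_mul]

lemma truncPow_eq_plusPow {b τ x : ℝ} (hx : x < b) (e : ℕ) :
    truncPow b τ e x = plusPow e (x - τ) := by
  rcases lt_or_ge x τ with h | h
  · rw [plusPow_of_neg (by linarith), truncPow, if_neg (by simp [h])]
  · rw [plusPow_of_nonneg (by linarith), truncPow, if_pos ⟨h, hx⟩]

lemma contDiffAt_plusPow_sub {e k : ℕ} {x τ : ℝ} (h : x ≠ τ ∨ k < e) :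
    ContDiffAt ℝ k (fun x => plusPow e (x - τ)) x := by
  rcases lt_trichotomy x τ with hx | rfl | hx
  · have : (fun x => plusPow e (x - τ)) =ᶠ[𝓝 x] fun _ => 0 := by
      filter_upwards [gt_mem_nhds hx] with y hy using plusPow_of_neg (by linarith)
    exact contDiffAt_const.congr_of_eventuallyEq this
  · have hk : k < e := by simpa using h
    obtain ⟨e, rfl⟩ : ∃ e', e = e' + 1 := ⟨e - 1, by omega⟩
    have h1 : ContDiff ℝ k (plusPow (e + 1)) :=
      (contDiff_plusPow e).of_le (by exact_mod_cast Nat.lt_succ_iff.1 hk)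
    exact (h1.comp (contDiff_id.sub contDiff_const)).contDiffAt
  · have : (fun x => plusPow e (x - τ)) =ᶠ[𝓝 x] fun x => (x - τ) ^ e := by
      filter_upwards [lt_mem_nhds hx] with y hy using plusPow_of_nonneg (by linarith)
    refine ContDiffAt.congr_of_eventuallyEq ?_ this
    fun_prop

lemma IsOpenKnots.truncPow_mem_pieceSpace (h : IsOpenKnots p n ξ r) {j i e : ℕ} (hj : j < n)
    (hi : i < p) (he : e ≤ p) (hie : i = 0 ∧ p < e + r j ∨ e = p) :
    truncPow (ξ n) (subKnot p ξ j i) e ∈ pieceSpace p n ξ r := by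
  rw [mem_pieceSpace]
  have hτ1 := h.le_subKnot i hj
  have hτ2 := h.subKnot_lt hj hi
  refine ⟨fun x hx => ?_, fun J hJ => ?_, fun J h0 hJ => ?_⟩
  · rw [truncPow, if_neg]
    exact fun hx' => hx ⟨((h.breakpoint_le (by omega) hj.le).trans hτ1).trans hx'.1, hx'.2⟩
  · have hxn : ∀ x, x ∈ Set.Ico (ξ J) (ξ (J + 1)) → x < ξ n := fun x hx =>
      hx.2.trans_le (h.breakpoint_le (by omega) le_rfl)
    rcases lt_trichotomy J j with hlt | rfl | hlt
    · refine ⟨0, 0, fun x hx => ?_⟩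
      have hxτ : x < subKnot p ξ j i := hx.2.trans_le ((h.breakpoint_le (by omega) hj.le).trans hτ1)
      rw [truncPow, if_neg (by simp [hxτ])]
      simp [locSpline]
    · by_cases hep : e = p
      · refine ⟨0, Pi.single i 1, fun x hx => ?_⟩
        rw [truncPow_eq_plusPow (hxn x hx), locSpline_zero, hep,
          sum_range_single_mul hi 1 (fun i => plusPow p (x - subKnot p ξ J i))]
        simp
      · obtain ⟨rfl, -⟩ : i = 0 ∧ p < e + r J := by tauto
        refine ⟨Pi.single e 1, 0, fun x hx => ?_⟩
        have : e < p := by omega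
        rw [truncPow_eq_plusPow (hxn x hx), locSpline_zero,
          sum_range_single_mul this 1 (fun k => (x - subKnot p ξ J 0) ^ k), plusPow_of_nonneg]
        · simp
        · rw [subKnot_zero]; linarith [hx.1]
    · -- binomial expansion at `ξ J`; the power of order `p` is a truncated one
      set d := ξ J - subKnot p ξ j i
      refine ⟨fun k => d ^ (e - k) * e.choose k, Pi.single 0 (d ^ (e - p) * e.choose p),
        fun x hx => ?_⟩
      have hxτ : subKnot p ξ j i ≤ x := hτ2.le.trans ((h.breakpoint_le (by omega) hJ.le).trans hx.1)
      rw [truncPow_eq_plusPow (hxn x hx), plusPow_of_nonneg (by linarith), locSpline_zero,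
        sum_range_single_mul h.degree_pos _ (fun i => plusPow p (x - subKnot p ξ J i)),
        subKnot_zero, plusPow_of_nonneg (by linarith [hx.1]),
        show x - subKnot p ξ j i = (x - ξ J) + d by simp only [d]; ring, add_pow,
        Finset.sum_subset (Finset.range_mono (by omega : e + 1 ≤ p + 1)), Finset.sum_range_succ]
      · congr 1
        · refine Finset.sum_congr rfl fun k _ => by ring
        · ring
      · intro k _ hk
        rw [Finset.mem_range] at hk
        rw [Nat.choose_eq_zero_of_lt (by omega)]; simp
  · have hev : truncPow (ξ n) (subKnot p ξ j i) e =ᶠ[𝓝 (ξ J)]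
        fun x => plusPow e (x - subKnot p ξ j i) := by
      filter_upwards [gt_mem_nhds (h.breakpoint_lt hJ le_rfl)] with y hy
        using truncPow_eq_plusPow hy e
    refine ContDiffAt.congr_of_eventuallyEq ?_ hev
    apply contDiffAt_plusPow_sub
    by_cases heq : ξ J = subKnot p ξ j i
    · right
      have hJj : J = j := by
        rcases lt_trichotomy J j with hlt | heq' | hlt
        · have := h.breakpoint_lt hlt hj.le; linarith
        · exact heq'
        · have := h.breakpoint_le (Nat.succ_le_of_lt hlt) hJ.le
          simp only [Nat.succ_eq_add_one] at this
          linarith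
      subst hJj
      have := h.interior J h0 hJ
      have := h.degree_pos
      omega
    · exact Or.inl heq

lemma IsOpenKnots.truncFamily_mem_pieceSpace (h : IsOpenKnots p n ξ r)
    (a : Σ j : Fin n, Fin (r j) ⊕ Fin (p - 1)) :
    truncFamily p n ξ r a ∈ pieceSpace p n ξ r := by
  obtain ⟨j, l | i⟩ := a
  · have h1 := h.le_of_lt_mult j.2 l.2
    have := h.truncPow_mem_pieceSpace (i := 0) (e := p - l) j.2 h.degree_pos (by omega)
      (Or.inl ⟨rfl, by have := l.2; omega⟩)
    rwa [subKnot_zero] at this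
  · exact h.truncPow_mem_pieceSpace (i := i + 1) (e := p) j.2 (by have := i.2; omega) le_rfl
      (Or.inr rfl)

lemma IsOpenKnots.subKnot_zero_le (h : IsOpenKnots p n ξ r) {j : ℕ} (hj : j < n) :
    ∀ i < p, subKnot p ξ j 0 ≤ subKnot p ξ j i := fun i _ => by
  rw [subKnot_zero]; exact h.le_subKnot i hj

/-- Proved by induction on the number `m` of elements on which `s` may be nonzero: subtracting the
truncated powers that start on the first of them leaves a spline supported further to the right. -/
lemma IsOpenKnots.mem_span_of_eq_zero_left (h : IsOpenKnots p n ξ r) {m : ℕ} (hm : m ≤ n)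
    {s : ℝ → ℝ} (hs : s ∈ pieceSpace p n ξ r) (h0 : ∀ x < ξ (n - m), s x = 0) :
    s ∈ Submodule.span ℝ (Set.range (truncFamily p n ξ r)) := by
  induction m generalizing s with
  | zero =>
    have : s = 0 := by
      ext x
      rcases lt_or_ge x (ξ n) with hx | hx
      · exact h0 x hx
      · exact hs.1 x (by simp [hx])
    rw [this]; exact zero_mem _
  | succ m ih =>
    obtain ⟨J, hJ⟩ : ∃ J, J = n - (m + 1) := ⟨_, rfl⟩
    have hJn : J < n := by omega
    have hJm : n - m = J + 1 := by omega
    rw [← hJ] at h0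
    obtain ⟨hs1, hs2, hs3⟩ := mem_pieceSpace.1 hs
    obtain ⟨α, c, hαc⟩ := hs2 J hJn
    have hp := h.degree_pos
    -- smoothness at the breakpoint makes the low-order jumps vanish
    have hα : ∀ k < p, k + r J ≤ p → α k = 0 := by
      intro k hk hkr
      have hJ0 : 0 < J := by
        rcases Nat.eq_zero_or_pos J with h' | h'
        · rw [h', h.first] at hkr; omega
        · exact h'
      have hcont := continuousAt_iteratedDeriv (hs3 J hJ0 hJn) (l := k) (by omega)
      have hR : Tendsto (iteratedDeriv k s) (𝓝[>] (ξ J))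
          (𝓝 (locSpline p (subKnot p ξ J) α c k (ξ J))) :=
        tendsto_iteratedDeriv_nhdsGT (m := p - 1) (h.lt_succ J hJn)
          (fun k hk => locSpline_hasDerivAt hk _ _ _) (continuous_locSpline (by omega) _ _ _)
          (fun x hx => hαc x ⟨hx.1.le, hx.2⟩) (by omega)
      have hL : Tendsto (iteratedDeriv k s) (𝓝[<] (ξ J)) (𝓝 0) := by
        refine tendsto_const_nhds.congr' ?_
        filter_upwards [self_mem_nhdsWithin] with x hx
        have : s =ᶠ[𝓝 x] 0 := by
          filter_upwards [gt_mem_nhds (Set.mem_Iio.1 hx)] with y hy using h0 y hy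
        rw [this.iteratedDeriv_eq]
        simp
      have e1 := tendsto_nhds_unique hR (hcont.tendsto.mono_left nhdsWithin_le_nhds)
      have e2 := tendsto_nhds_unique hL (hcont.tendsto.mono_left nhdsWithin_le_nhds)
      have e3 := locSpline_left hk (h.subKnot_zero_le hJn) α c
      rw [subKnot_zero, e1, ← e2] at e3
      have : (k.factorial : ℝ) ≠ 0 := by exact_mod_cast k.factorial_ne_zero
      simpa [this] using e3.symm
    -- the part of `s` that starts on the `J`-th element
    set G : ℝ → ℝ := ∑ k ∈ Finset.range p, α k • truncPow (ξ n) (ξ J) k +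
      ∑ i ∈ Finset.range p, c i • truncPow (ξ n) (subKnot p ξ J i) p with hG
    have hbp : ∀ k ≤ p, p < k + r J →
        ∃ a, truncFamily p n ξ r a = truncPow (ξ n) (ξ J) k := by
      intro k hk hkr
      refine ⟨⟨⟨J, hJn⟩, Sum.inl ⟨p - k, by simp; omega⟩⟩, ?_⟩
      simp only [truncFamily]
      rw [Nat.sub_sub_self hk]
    have hr1 : 1 ≤ r J := by
      rcases Nat.eq_zero_or_pos J with h' | h'
      · rw [h', h.first]; omega
      · exact (h.interior J h' hJn).1
    have hGmem : ∀ W : Submodule ℝ (ℝ → ℝ), (∀ a, truncFamily p n ξ r a ∈ W) → G ∈ W := by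
      intro W hW
      refine W.add_mem (W.sum_mem fun k hk => ?_) (W.sum_mem fun i hi => W.smul_mem _ ?_)
      · rw [Finset.mem_range] at hk
        rcases le_or_gt (k + r J) p with h' | h'
        · rw [hα k hk h', zero_smul]; exact W.zero_mem
        · obtain ⟨a, ha⟩ := hbp k hk.le h'
          rw [← ha]; exact W.smul_mem _ (hW a)
      · rw [Finset.mem_range] at hi
        rcases Nat.eq_zero_or_pos i with rfl | hi0
        · obtain ⟨a, ha⟩ := hbp p le_rfl (by omega)
          rw [subKnot_zero, ← ha]; exact hW a
        · have := hW ⟨⟨J, hJn⟩, Sum.inr ⟨i - 1, by omega⟩⟩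
          simp only [truncFamily, Nat.sub_add_cancel hi0] at this
          exact this
    have hdiff : s - G ∈ Submodule.span ℝ (Set.range (truncFamily p n ξ r)) := by
      apply ih (by omega)
      · exact Submodule.sub_mem _ hs (hGmem _ h.truncFamily_mem_pieceSpace)
      · intro x hx
        rw [hJm] at hx
        have hxn : x < ξ n := hx.trans_le (h.breakpoint_le (by omega) le_rfl)
        have hGx : G x = ∑ k ∈ Finset.range p, α k * plusPow k (x - ξ J) +
            ∑ i ∈ Finset.range p, c i * plusPow p (x - subKnot p ξ J i) := by
          simp only [hG, Pi.add_apply, Finset.sum_apply, Pi.smul_apply, smul_eq_mul,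
            truncPow_eq_plusPow hxn]
        rw [Pi.sub_apply, hGx]
        rcases lt_or_ge x (ξ J) with h' | h'
        · rw [h0 x h', Finset.sum_eq_zero, Finset.sum_eq_zero]
          · simp
          · intro i _
            rw [plusPow_of_neg (by linarith [h.le_subKnot i hJn]), mul_zero]
          · intro i _
            rw [plusPow_of_neg (by linarith), mul_zero]
        · rw [hαc x ⟨h', hx⟩, locSpline_zero, subKnot_zero]
          simp only [plusPow_of_nonneg (sub_nonneg.2 h')]
          ring
    have := Submodule.add_mem _ hdiff (hGmem _ fun a => Submodule.subset_span ⟨a, rfl⟩)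
    rwa [sub_add_cancel] at this

/-- The B-spline space consists of the piecewise polynomials with the smoothness prescribed by the
knots. -/
lemma IsOpenKnots.splineSpace_eq_pieceSpace (h : IsOpenKnots p n ξ r) :
    splineSpace p n ξ r = pieceSpace p n ξ r := by
  rw [h.splineSpace_eq_span_truncFamily]
  apply le_antisymm
  · rw [Submodule.span_le]
    rintro _ ⟨a, rfl⟩
    exact h.truncFamily_mem_pieceSpace a
  · intro s hs
    refine h.mem_span_of_eq_zero_left le_rfl hs fun x hx => hs.1 x ?_
    rw [Nat.sub_self] at hx
    exact fun h' => absurd h'.1 (not_le.2 hx)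

end PieceSpace

/-! ### Sobolev functions on an interval -/

/-- Fundamental lemma of the calculus of variations on an interval. -/
lemma ae_eq_zero_of_forall_test {a b : ℝ} {F : ℝ → ℝ} (hF : LocallyIntegrableOn F (Set.Ioo a b))
    (h : ∀ φ : ℝ → ℝ, ContDiff ℝ ∞ φ → HasCompactSupport φ → tsupport φ ⊆ Set.Ioo a b →
      ∫ x in Set.Ioo a b, F x * φ x = 0) :
    ∀ᵐ x ∂(volume.restrict (Set.Ioo a b)), F x = 0 := by
  rw [ae_restrict_iff' measurableSet_Ioo]
  refine isOpen_Ioo.ae_eq_zero_of_integral_contDiff_smul_eq_zero hF fun φ h1 h2 h3 => ?_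
  rw [← h φ h1 h2 h3, setIntegral_eq_integral_of_forall_compl_eq_zero]
  · simp only [smul_eq_mul, mul_comm]
  · intro x hx
    rw [image_eq_zero_of_notMem_tsupport (fun hx' => hx (h3 hx')), mul_zero]

/-- The product of a locally integrable function with a test function is integrable. -/
lemma integrableOn_mul_test {a b : ℝ} {F φ : ℝ → ℝ} (hF : LocallyIntegrableOn F (Set.Ioo a b))
    (hφ : Continuous φ) (hc : HasCompactSupport φ) (hs : tsupport φ ⊆ Set.Ioo a b) :
    IntegrableOn (fun x => F x * φ x) (Set.Ioo a b) := by
  have h1 : IntegrableOn F (tsupport φ) := hF.integrableOn_compact_subset hs hc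
  have h2 : IntegrableOn (fun x => F x * φ x) (tsupport φ) :=
    h1.mul_continuousOn hφ.continuousOn hc
  have h3 : Integrable (fun x => F x * φ x) := by
    rw [← integrableOn_iff_integrable_of_support_subset (s := tsupport φ)]
    · exact h2
    · intro x hx
      rw [Function.mem_support] at hx
      exact subset_tsupport φ (fun h => hx (by simp [h]))
  exact h3.integrableOn

lemma HasWeakDeriv.ae_unique {a b : ℝ} {l : ℕ} {f g g' : ℝ → ℝ}
    (h : HasWeakDeriv l f g (Set.Ioo a b)) (h' : HasWeakDeriv l f g' (Set.Ioo a b)) :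
    g =ᵐ[volume.restrict (Set.Ioo a b)] g' := by
  have hz := ae_eq_zero_of_forall_test (F := fun x => g x - g' x) (h.2.1.sub h'.2.1) ?_
  · filter_upwards [hz] with x hx using sub_eq_zero.1 hx
  · intro φ h1 h2 h3
    have e1 := h.2.2 φ h1 h2 h3
    have e2 := h'.2.2 φ h1 h2 h3
    rw [e1] at e2
    have e3 := mul_left_cancel₀ (pow_ne_zero l (by norm_num : (-1 : ℝ) ≠ 0)) e2
    simp only [sub_mul]
    rw [integral_sub (integrableOn_mul_test h.2.1 h1.continuous h2 h3)
      (integrableOn_mul_test h'.2.1 h1.continuous h2 h3), e3, sub_self]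

/-- The infimum in the definition of the seminorm is attained at every weak derivative. -/
lemma HasWeakDeriv.seminormH_eq {a b : ℝ} {l : ℕ} {f g : ℝ → ℝ}
    (h : HasWeakDeriv l f g (Set.Ioo a b)) :
    seminormH l f (Set.Ioo a b) = eLpNorm g 2 (volume.restrict (Set.Ioo a b)) := by
  apply le_antisymm
  · exact iInf₂_le g h
  · exact le_iInf₂ fun g' h' => (eLpNorm_congr_ae (h.ae_unique h')).le

lemma HasWeakDeriv.zero_ae_eq {a b : ℝ} {f g : ℝ → ℝ}
    (h : HasWeakDeriv 0 f g (Set.Ioo a b)) : f =ᵐ[volume.restrict (Set.Ioo a b)] g := by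
  refine HasWeakDeriv.ae_unique (l := 0) (f := f) ⟨h.1, h.1, fun φ _ _ _ => ?_⟩ h
  simp

lemma iteratedDeriv_tsupport_subset (φ : ℝ → ℝ) (k : ℕ) :
    tsupport (iteratedDeriv k φ) ⊆ tsupport φ := by
  induction k with
  | zero => simp
  | succ k ih =>
    rw [iteratedDeriv_succ]
    exact (tsupport_deriv_subset (𝕜 := ℝ)).trans ih

lemma contDiff_iteratedDeriv_infty {φ : ℝ → ℝ} (h : ContDiff ℝ ∞ φ) (k : ℕ) :
    ContDiff ℝ ∞ (iteratedDeriv k φ) := by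
  induction k with
  | zero => simpa using h
  | succ k ih =>
    rw [iteratedDeriv_succ]
    exact (contDiff_infty_iff_deriv.1 ih).2

/-- Consecutive weak derivatives of one function are related by a weak derivative of order one. -/
lemma HasWeakDeriv.succ_of {a b : ℝ} {k : ℕ} {f g g' : ℝ → ℝ}
    (h : HasWeakDeriv k f g (Set.Ioo a b)) (h' : HasWeakDeriv (k + 1) f g' (Set.Ioo a b)) :
    HasWeakDeriv 1 g g' (Set.Ioo a b) := by
  refine ⟨h.2.1, h'.2.1, fun φ h1 h2 h3 => ?_⟩
  have hs : tsupport (deriv φ) ⊆ tsupport φ := tsupport_deriv_subset (𝕜 := ℝ)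
  have e1 := h.2.2 (deriv φ) (contDiff_infty_iff_deriv.1 h1).2
    (h2.mono' (subset_tsupport _ |>.trans hs)) (hs.trans h3)
  have e2 := h'.2.2 φ h1 h2 h3
  rw [← iteratedDeriv_succ', e2, pow_succ] at e1
  rw [iteratedDeriv_one]
  have hne : ((-1 : ℝ) ^ k) ≠ 0 := pow_ne_zero _ (by norm_num)
  apply mul_left_cancel₀ hne
  rw [← e1]; ring

lemma exists_Icc_of_isCompact_subset_Ioo {a b : ℝ} (hab : a < b) {K : Set ℝ} (hK : IsCompact K)
    (hs : K ⊆ Set.Ioo a b) : ∃ a' b', a < a' ∧ b' < b ∧ K ⊆ Set.Icc a' b' := by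
  rcases K.eq_empty_or_nonempty with rfl | hne
  · exact ⟨(a + b) / 2, (a + b) / 2, by linarith, by linarith, by simp⟩
  · obtain ⟨x, hx⟩ := hK.exists_isLeast hne
    obtain ⟨y, hy⟩ := hK.exists_isGreatest hne
    exact ⟨x, y, (hs hx.1).1, (hs hy.1).2, fun z hz => ⟨hx.2 hz, hy.2 hz⟩⟩

/-- A test function with vanishing integral is the derivative of a test function. -/
lemma exists_test_primitive {a b : ℝ} (hab : a < b) {η : ℝ → ℝ} (h1 : ContDiff ℝ ∞ η)
    (h2 : HasCompactSupport η) (h3 : tsupport η ⊆ Set.Ioo a b) (h0 : ∫ x in a..b, η x = 0) :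
    ∃ φ : ℝ → ℝ, ContDiff ℝ ∞ φ ∧ HasCompactSupport φ ∧ tsupport φ ⊆ Set.Ioo a b ∧
      deriv φ = η := by
  obtain ⟨a', b', ha, hb, hK⟩ := exists_Icc_of_isCompact_subset_Ioo hab h2 h3
  have hη0 : ∀ x, x ∉ Set.Icc a' b' → η x = 0 := fun x hx =>
    image_eq_zero_of_notMem_tsupport (fun h => hx (hK h))
  have hint : ∀ x y, IntervalIntegrable η volume x y := fun x y =>
    h1.continuous.intervalIntegrable x y
  have hd : ∀ x, HasDerivAt (fun x => ∫ y in a..x, η y) (η x) x := fun x =>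
    intervalIntegral.integral_hasDerivAt_right (hint a x)
      (h1.continuous.stronglyMeasurableAtFilter _ _) h1.continuous.continuousAt
  have hderiv : deriv (fun x => ∫ y in a..x, η y) = η := funext fun x => (hd x).deriv
  have hφ0 : ∀ x, x ∉ Set.Icc a' b' → ∫ y in a..x, η y = 0 := by
    intro x hx
    rw [Set.mem_Icc, not_and_or, not_le, not_le] at hx
    rcases hx with hx | hx
    · rw [intervalIntegral.integral_congr (g := fun _ => 0)]
      · simp
      · intro y hy
        refine hη0 y fun hy' => ?_
        have := (Set.mem_uIcc.1 hy)
        rcases this with h | h <;> linarith [hy'.1, h.1, h.2]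
    · have hxb : ∫ y in x..b, η y = 0 := by
        rw [intervalIntegral.integral_congr (g := fun _ => 0)]
        · simp
        · intro y hy
          refine hη0 y fun hy' => ?_
          have := (Set.mem_uIcc.1 hy)
          rcases this with h | h <;> linarith [hy'.2, h.1, h.2]
      have := intervalIntegral.integral_add_adjacent_intervals (hint a x) (hint x b)
      rw [hxb, h0, add_zero] at this
      exact this
  have hsupp : tsupport (fun x => ∫ y in a..x, η y) ⊆ Set.Icc a' b' := by
    apply closure_minimal _ isClosed_Icc
    intro x hx
    by_contra h
    exact hx (hφ0 x h)
  refine ⟨fun x => ∫ y in a..x, η y, ?_, ?_, ?_, hderiv⟩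
  · rw [contDiff_infty_iff_deriv, hderiv]
    exact ⟨fun x => (hd x).differentiableAt, h1⟩
  · exact HasCompactSupport.intro isCompact_Icc hφ0
  · exact hsupp.trans fun x hx => ⟨ha.trans_le hx.1, hx.2.trans_lt hb⟩

lemma integral_Ioo_eq_interval {a b : ℝ} (hab : a ≤ b) (f : ℝ → ℝ) :
    ∫ x in Set.Ioo a b, f x = ∫ x in a..b, f x := by
  rw [intervalIntegral.integral_of_le hab, integral_Ioc_eq_integral_Ioo]

/-- The du Bois-Reymond lemma. -/
lemma ae_eq_const_of_weakDeriv_zero {a b : ℝ} (hab : a < b) {F : ℝ → ℝ}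
    (hF : LocallyIntegrableOn F (Set.Ioo a b))
    (h : ∀ φ : ℝ → ℝ, ContDiff ℝ ∞ φ → HasCompactSupport φ → tsupport φ ⊆ Set.Ioo a b →
      ∫ x in Set.Ioo a b, F x * deriv φ x = 0) :
    ∃ c, ∀ᵐ x ∂(volume.restrict (Set.Ioo a b)), F x = c := by
  let B : ContDiffBump ((a + b) / 2) := ⟨(b - a) / 8, (b - a) / 4, by linarith, by linarith⟩
  set θ : ℝ → ℝ := B.normed volume
  have hθ1 : ContDiff ℝ ∞ θ := B.contDiff_normed
  have hθ2 : HasCompactSupport θ := B.hasCompactSupport_normed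
  have hθ3 : tsupport θ ⊆ Set.Ioo a b := by
    rw [B.tsupport_normed_eq, Real.closedBall_eq_Icc]
    intro x hx
    have h1 : B.rOut = (b - a) / 4 := rfl
    rw [h1] at hx
    exact ⟨by linarith [hx.1], by linarith [hx.2]⟩
  have hθ4 : ∫ x in a..b, θ x = 1 := by
    rw [← integral_Ioo_eq_interval hab.le, setIntegral_eq_integral_of_forall_compl_eq_zero]
    · exact B.integral_normed
    · exact fun x hx => image_eq_zero_of_notMem_tsupport fun hx' => hx (hθ3 hx')
  set c := ∫ x in Set.Ioo a b, F x * θ x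
  have hFc : LocallyIntegrableOn (fun x => F x - c) (Set.Ioo a b) :=
    hF.sub ((locallyIntegrable_const c).locallyIntegrableOn _)
  refine ⟨c, ?_⟩
  have hz := ae_eq_zero_of_forall_test hFc ?_
  · filter_upwards [hz] with x hx using sub_eq_zero.1 hx
  intro ψ h1 h2 h3
  -- subtracting a multiple of `θ` makes the integral of `ψ` zero
  set m := ∫ x in a..b, ψ x with hm
  have hη1 : ContDiff ℝ ∞ (fun x => ψ x - m * θ x) := h1.sub (contDiff_const.mul hθ1)
  have key := exists_test_primitive hab hη1 (h2.sub (hθ2.mul_left (f := fun _ => m))) ?_ ?_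
  · obtain ⟨φ, hφ1, hφ2, hφ3, hφ4⟩ := key
    have := h φ hφ1 hφ2 hφ3
    rw [hφ4] at this
    have i1 := integrableOn_mul_test hF h1.continuous h2 h3
    have i2 := integrableOn_mul_test hF hθ1.continuous hθ2 hθ3
    have i3 : IntegrableOn (fun x => c * ψ x) (Set.Ioo a b) :=
      integrableOn_mul_test ((locallyIntegrable_const c).locallyIntegrableOn _) h1.continuous h2 h3
    simp only [sub_mul]
    rw [integral_sub i1 i3, integral_const_mul, integral_Ioo_eq_interval hab.le ψ, ← hm]
    have e : ∀ x, F x * (ψ x - m * θ x) = F x * ψ x - m * (F x * θ x) := fun x => by ring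
    simp only [e] at this
    rw [integral_sub i1 (i2.const_mul m), integral_const_mul] at this
    rw [← this]; ring
  · intro x hx
    by_contra hx'
    apply hx'
    have : tsupport (fun x => ψ x - m * θ x) ⊆ tsupport ψ ∪ tsupport θ := by
      apply closure_minimal _ ((isClosed_tsupport _).union (isClosed_tsupport _))
      intro y hy
      by_contra hy'
      rw [Set.mem_union, not_or] at hy'
      apply hy
      simp [image_eq_zero_of_notMem_tsupport hy'.1, image_eq_zero_of_notMem_tsupport hy'.2]
    rcases this hx with h' | h'
    · exact h3 h'
    · exact hθ3 h'
  · rw [intervalIntegral.integral_sub (h1.continuous.intervalIntegrable _ _)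
      ((hθ1.continuous.intervalIntegrable _ _).const_mul m),
      intervalIntegral.integral_const_mul, hθ4, ← hm]
    ring

lemma integral_primitive_mul_deriv {a b : ℝ} {g φ : ℝ → ℝ}
    (hg : IntervalIntegrable g volume a b) (h1 : ContDiff ℝ ∞ φ)
    (h2 : HasCompactSupport φ) (h3 : tsupport φ ⊆ Set.Ioo a b) :
    ∫ x in a..b, (∫ y in a..x, g y) * deriv φ x = - ∫ x in a..b, g x * φ x := by
  have hG := hg.absolutelyContinuousOnInterval_intervalIntegral (c := a) (by simp)
  obtain ⟨C, hC⟩ := ContDiff.lipschitzWith_of_hasCompactSupport h2 h1 (by simp)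
  have hφ : AbsolutelyContinuousOnInterval φ a b :=
    (hC.lipschitzOnWith (s := Set.uIcc a b)).absolutelyContinuousOnInterval
  have hb0 : φ b = 0 := image_eq_zero_of_notMem_tsupport fun h => by simpa using h3 h
  rw [hG.integral_mul_deriv_eq_deriv_mul hφ, hb0, intervalIntegral.integral_same]
  have : ∫ x in a..b, deriv (fun x => ∫ y in a..x, g y) x * φ x = ∫ x in a..b, g x * φ x := by
    apply intervalIntegral.integral_congr_ae
    filter_upwards [hg.ae_hasDerivAt_integral] with x hx hx'
    rw [(hx (Set.uIoc_subset_uIcc hx') a (by simp)).deriv]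
  rw [this]; ring

/-- A function with integrable weak derivative is, up to a null set, a primitive of it. -/
lemma HasWeakDeriv.ae_eq_primitive {a b : ℝ} (hab : a < b) {f g : ℝ → ℝ}
    (h : HasWeakDeriv 1 f g (Set.Ioo a b)) (hg : IntegrableOn g (Set.Ioo a b)) :
    ∃ c, ∀ᵐ x ∂(volume.restrict (Set.Ioo a b)), f x = c + ∫ y in a..x, g y := by
  have hgi : IntervalIntegrable g volume a b := by
    rwa [intervalIntegrable_iff_integrableOn_Ioo_of_le hab.le]
  have hGc : ContinuousOn (fun x => ∫ y in a..x, g y) (Set.Ioo a b) := by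
    have := intervalIntegral.continuousOn_primitive_interval' hgi (a := a) (by simp)
    exact this.mono (Set.Ioo_subset_Icc_self.trans Set.Icc_subset_uIcc)
  have hGl : LocallyIntegrableOn (fun x => ∫ y in a..x, g y) (Set.Ioo a b) :=
    hGc.locallyIntegrableOn measurableSet_Ioo
  have key := ae_eq_const_of_weakDeriv_zero hab (F := fun x => f x - ∫ y in a..x, g y)
    (h.1.sub hGl) ?_
  · obtain ⟨c, hc⟩ := key
    exact ⟨c, by filter_upwards [hc] with x hx; rw [← hx]; ring⟩
  intro φ h1 h2 h3
  have hs : tsupport (deriv φ) ⊆ tsupport φ := tsupport_deriv_subset (𝕜 := ℝ)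
  have hc' : HasCompactSupport (deriv φ) := h2.mono' ((subset_tsupport _).trans hs)
  have hcd := (contDiff_infty_iff_deriv.1 h1).2.continuous
  simp only [sub_mul]
  rw [integral_sub (integrableOn_mul_test h.1 hcd hc' (hs.trans h3))
    (integrableOn_mul_test hGl hcd hc' (hs.trans h3))]
  have e1 := h.2.2 φ h1 h2 h3
  rw [iteratedDeriv_one] at e1
  rw [e1, integral_Ioo_eq_interval hab.le, integral_Ioo_eq_interval hab.le,
    integral_primitive_mul_deriv hgi h1 h2 h3]
  ring

/-- Successive weak derivatives are, up to null sets, the successive derivatives of one function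
of class `C^m` on the line. -/
lemma exists_chain_of_weakDeriv {a b : ℝ} (hab : a < b) (m : ℕ) (g : ℕ → ℝ → ℝ)
    (hd : ∀ k ≤ m, HasWeakDeriv 1 (g k) (g (k + 1)) (Set.Ioo a b))
    (hi : ∀ k ≤ m, IntegrableOn (g (k + 1)) (Set.Ioo a b)) :
    ∃ U : ℕ → ℝ → ℝ, (∀ k < m, ∀ x, HasDerivAt (U k) (U (k + 1) x) x) ∧ Continuous (U m) ∧
      (∀ᵐ x ∂(volume.restrict (Set.Ioo a b)), g 0 x = U 0 x) ∧
      ∀ x ∈ Set.Icc a b, U m x - U m a = ∫ y in a..x, g (m + 1) y := by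
  induction m generalizing g with
  | zero =>
    obtain ⟨c, hc⟩ := (hd 0 le_rfl).ae_eq_primitive hab (hi 0 le_rfl)
    -- cutting `g` off outside the interval extends the primitive to the line
    have hI : Integrable ((Set.Ioo a b).indicator (g 1)) :=
      (integrable_indicator_iff measurableSet_Ioo).2 (hi 0 le_rfl)
    have hEq : ∀ x ∈ Set.Icc a b,
        ∫ y in a..x, (Set.Ioo a b).indicator (g 1) y = ∫ y in a..x, g 1 y := by
      intro x hx
      rw [intervalIntegral.integral_of_le hx.1, intervalIntegral.integral_of_le hx.1,
        integral_Ioc_eq_integral_Ioo, integral_Ioc_eq_integral_Ioo]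
      refine setIntegral_congr_fun measurableSet_Ioo fun y hy => ?_
      exact Set.indicator_of_mem (show y ∈ Set.Ioo a b from ⟨hy.1, hy.2.trans_le hx.2⟩) _
    refine ⟨fun _ x => c + ∫ y in a..x, (Set.Ioo a b).indicator (g 1) y, by simp, ?_, ?_, ?_⟩
    · exact continuous_const.add (hI.continuous_primitive a)
    · filter_upwards [hc, ae_restrict_mem measurableSet_Ioo] with x hx hx'
      rw [hx, hEq x (Set.Ioo_subset_Icc_self hx')]
    · intro x hx
      simp only [hEq x hx, intervalIntegral.integral_same]; ring
  | succ m ih =>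
    obtain ⟨U, hU1, hU2, hU3, hU4⟩ := ih (fun k => g (k + 1)) (fun k hk => hd (k + 1) (by omega))
      (fun k hk => hi (k + 1) (by omega))
    obtain ⟨c, hc⟩ := (hd 0 (by omega)).ae_eq_primitive hab (hi 0 (by omega))
    have hU0 : Continuous (U 0) := continuous_chain hU1 hU2 (Nat.zero_le m)
    refine ⟨fun k => Nat.casesOn k (fun x => c + ∫ y in a..x, U 0 y) U, ?_, hU2, ?_, hU4⟩
    · intro k hk x
      rcases k with _ | k
      · exact (intervalIntegral.integral_hasDerivAt_right (hU0.intervalIntegrable a x)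
          (hU0.stronglyMeasurableAtFilter _ _) hU0.continuousAt).const_add c
      · exact hU1 k (by omega) x
    · filter_upwards [hc, ae_restrict_mem measurableSet_Ioo] with x hx hx'
      rw [hx]
      congr 1
      rw [intervalIntegral.integral_of_le hx'.1.le, intervalIntegral.integral_of_le hx'.1.le]
      apply integral_congr_ae
      exact ae_restrict_of_ae_restrict_of_subset
        (show Set.Ioc a x ⊆ Set.Ioo a b from fun y hy => ⟨hy.1, hy.2.trans_lt hx'.2⟩) hU3

/-- A continuous function in `H^{m+1}(a, b)` has an extension of class `C^m` whose derivative of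
order `m` is a primitive of the weak derivative of order `m + 1`. -/
lemma MemSobolev.exists_chain {a b : ℝ} (hab : a < b) {m : ℕ} {u : ℝ → ℝ}
    (hu : MemSobolev (m + 1) u (Set.Ioo a b)) (hc : ContinuousOn u (Set.Ioo a b)) :
    ∃ (U : ℕ → ℝ → ℝ) (g : ℝ → ℝ), (∀ k < m, ∀ x, HasDerivAt (U k) (U (k + 1) x) x) ∧
      Continuous (U m) ∧ Set.EqOn u (U 0) (Set.Ioo a b) ∧
      HasWeakDeriv (m + 1) u g (Set.Ioo a b) ∧ MemLp g 2 (volume.restrict (Set.Ioo a b)) ∧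
      ∀ x ∈ Set.Icc a b, U m x - U m a = ∫ y in a..x, g y := by
  choose! G hG1 hG2 using hu
  have hfin : IsFiniteMeasure (volume.restrict (Set.Ioo a b)) := by
    constructor; simp
  obtain ⟨U, hU1, hU2, hU3, hU4⟩ := exists_chain_of_weakDeriv hab m G
    (fun k hk => (hG1 k (by omega)).succ_of (hG1 (k + 1) (by omega)))
    (fun k hk => (hG2 (k + 1) (by omega)).integrable (by norm_num))
  refine ⟨U, G (m + 1), hU1, hU2, ?_, hG1 (m + 1) le_rfl, hG2 (m + 1) le_rfl, hU4⟩
  refine Measure.eqOn_open_of_ae_eq (μ := volume) ?_ isOpen_Ioo hc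
    (continuous_chain hU1 hU2 (Nat.zero_le m)).continuousOn
  exact (hG1 0 (by omega)).zero_ae_eq.trans hU3

/-! ### Chains of derivatives and step functions -/

/-- A sequence `E 0, ..., E p` in which every function is the right derivative of the one before,
continuous except for the last one, which is only locally integrable. -/
structure RightChain (p : ℕ) (E : ℕ → ℝ → ℝ) : Prop where
  deriv : ∀ k < p, ∀ x, HasDerivWithinAt (E k) (E (k + 1) x) (Set.Ioi x) x
  cont : ∀ k < p, Continuous (E k)
  integrable : ∀ x y, IntervalIntegrable (E p) volume x y

lemma RightChain.intervalIntegrable {p : ℕ} {E : ℕ → ℝ → ℝ} (h : RightChain p E) {k : ℕ}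
    (hk : k ≤ p) (x y : ℝ) : IntervalIntegrable (E k) volume x y := by
  rcases hk.lt_or_eq with hk | rfl
  · exact (h.cont k hk).intervalIntegrable x y
  · exact h.integrable x y

lemma RightChain.sub {p : ℕ} {E F : ℕ → ℝ → ℝ} (h : RightChain p E) (h' : RightChain p F) :
    RightChain p (fun k x => E k x - F k x) where
  deriv k hk x := (h.deriv k hk x).sub (h'.deriv k hk x)
  cont k hk := (h.cont k hk).sub (h'.cont k hk)
  integrable x y := (h.integrable x y).sub (h'.integrable x y)

lemma rightChain_of_hasDerivAt {p : ℕ} {U : ℕ → ℝ → ℝ}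
    (hU : ∀ k < p, ∀ x, HasDerivAt (U k) (U (k + 1) x) x) (hc : Continuous (U p)) :
    RightChain p U where
  deriv k hk x := (hU k hk x).hasDerivWithinAt
  cont _ hk := continuous_chain hU hc hk.le
  integrable x y := hc.intervalIntegrable x y

/-- Repeated integration by parts; the boundary terms vanish because of the chain, so that no
boundary condition on `φ` is needed. -/
lemma RightChain.integral_mul_iteratedDeriv {p : ℕ} {E : ℕ → ℝ → ℝ} (h : RightChain p E)
    {a b : ℝ} (ha : ∀ k < p, E k a = 0) (hb : ∀ k < p, E k b = 0) {l : ℕ} (hl : l ≤ p)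
    {φ : ℝ → ℝ} (hφ : ContDiff ℝ ∞ φ) :
    ∫ x in a..b, E 0 x * iteratedDeriv l φ x = (-1) ^ l * ∫ x in a..b, E l x * φ x := by
  induction l generalizing φ with
  | zero => simp
  | succ l ih =>
    have hφ' := contDiff_infty_iff_deriv.1 hφ
    rw [iteratedDeriv_succ', ih (by omega) hφ'.2,
      intervalIntegral.integral_mul_deriv_eq_deriv_mul_of_hasDeriv_right
        (h.cont l (by omega)).continuousOn hφ.continuous.continuousOn
        (fun x _ => h.deriv l (by omega) x)
        (fun x _ => (hφ'.1 x).hasDerivAt.hasDerivWithinAt)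
        (h.intervalIntegrable hl a b) (hφ'.2.continuous.intervalIntegrable a b),
      ha l (by omega), hb l (by omega)]
    ring

lemma iteratedDeriv_polynomial (q : Polynomial ℝ) (k : ℕ) :
    iteratedDeriv k (fun x => q.eval x) = fun x => (Polynomial.derivative^[k] q).eval x := by
  induction k with
  | zero => simp
  | succ k ih =>
    rw [iteratedDeriv_succ, ih, Function.iterate_succ_apply']
    ext x
    exact Polynomial.deriv _

lemma RightChain.integral_mul_polynomial {p : ℕ} {E : ℕ → ℝ → ℝ} (h : RightChain p E)
    {a b : ℝ} (ha : ∀ k < p, E k a = 0) (hb : ∀ k < p, E k b = 0) {q : Polynomial ℝ}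
    (hq : q.natDegree < p) : ∫ x in a..b, E p x * q.eval x = 0 := by
  have h1 := h.integral_mul_iteratedDeriv ha hb le_rfl (φ := fun x => q.eval x)
    (by simpa using q.contDiff_aeval (𝕜 := ℝ) ∞)
  rw [iteratedDeriv_polynomial, Polynomial.iterate_derivative_eq_zero hq] at h1
  simp only [Polynomial.eval_zero, mul_zero, intervalIntegral.integral_zero] at h1
  have hne : ((-1 : ℝ) ^ p) ≠ 0 := pow_ne_zero _ (by norm_num)
  exact (mul_eq_zero.1 h1.symm).resolve_left hne

/-- A bound on the last function of a chain starting at zero bounds all of them. -/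
lemma RightChain.abs_le {p : ℕ} {E : ℕ → ℝ → ℝ} (h : RightChain p E) {a b B : ℝ}
    (ha : ∀ k < p, E k a = 0) (hB : ∀ x ∈ Set.Ico a b, |E p x| ≤ B) {m : ℕ} (hm : m ≤ p) :
    ∀ x ∈ Set.Ico a b, |E (p - m) x| ≤ (b - a) ^ m * B := by
  induction m with
  | zero => simpa using hB
  | succ m ih =>
    intro x hx
    have hk : p - (m + 1) < p := by omega
    have hk' : p - (m + 1) + 1 = p - m := by omega
    have hftc := intervalIntegral.integral_eq_sub_of_hasDeriv_right (a := a) (b := x)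
      (h.cont _ hk).continuousOn (fun y _ => h.deriv _ hk y)
      (h.intervalIntegrable (by omega) a x)
    rw [ha _ hk, sub_zero, hk'] at hftc
    have hB0 : 0 ≤ B := (abs_nonneg _).trans (hB x hx)
    have hab : 0 ≤ b - a := by linarith [hx.1, hx.2]
    rw [← hftc]
    have := intervalIntegral.norm_integral_le_of_norm_le_const (a := a) (b := x)
      (f := E (p - m)) (C := (b - a) ^ m * B) ?_
    · rw [Real.norm_eq_abs] at this
      refine this.trans ?_
      rw [abs_of_nonneg (by linarith [hx.1])]
      have h2 : x - a ≤ b - a := by linarith [hx.2]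
      calc (b - a) ^ m * B * (x - a) ≤ (b - a) ^ m * B * (b - a) := by gcongr
        _ = (b - a) ^ (m + 1) * B := by ring
    · intro y hy
      rw [Set.uIoc_of_le hx.1] at hy
      exact ih (by omega) y ⟨hy.1.le, hy.2.trans_lt hx.2⟩

/-- The polynomials of degree at most `p` which interpolate a step function at the points `k / p`;
their derivatives are dual, on polynomials of degree less than `p`, to the step functions on
the uniform subdivision. -/
lemma exists_stepPoly (p : ℕ) (hp : 1 ≤ p) : ∃ (Q : ℕ → Polynomial ℝ) (M : ℝ), 0 ≤ M ∧
    (∀ i < p, (Q i).natDegree ≤ p) ∧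
    (∀ i < p, ∀ k ≤ p, (Q i).eval ((k : ℝ) / p) = if k ≤ i then 0 else 1) ∧
    ∀ i < p, ∀ x ∈ Set.Icc (0 : ℝ) 1, |(Q i).derivative.eval x| ≤ M := by
  have hp' : (p : ℝ) ≠ 0 := by exact_mod_cast (by omega)
  have hinj : Set.InjOn (fun k : ℕ => (k : ℝ) / p) (Finset.range (p + 1)) := by
    intro k _ k' _ h
    have h' : (k : ℝ) / p = (k' : ℝ) / p := h
    rw [div_left_inj' hp'] at h'
    exact_mod_cast h'
  let Q : ℕ → Polynomial ℝ := fun i => Lagrange.interpolate (Finset.range (p + 1))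
    (fun k : ℕ => (k : ℝ) / p) (fun k => if k ≤ i then 0 else 1)
  have hb : ∀ i, ∃ M, ∀ x ∈ Set.Icc (0 : ℝ) 1, |(Q i).derivative.eval x| ≤ M := fun i => by
    obtain ⟨M, hM⟩ := isCompact_Icc.exists_bound_of_continuousOn (s := Set.Icc (0 : ℝ) 1)
      (f := fun x => (Q i).derivative.eval x) (Polynomial.continuous _).continuousOn
    exact ⟨M, hM⟩
  choose M hM using hb
  refine ⟨Q, ∑ i ∈ Finset.range p, |M i|, Finset.sum_nonneg fun i _ => abs_nonneg _, ?_, ?_, ?_⟩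
  · intro i _
    have := Lagrange.degree_interpolate_le (r := fun k => if k ≤ i then (0 : ℝ) else 1) hinj
    rw [Finset.card_range] at this
    exact Polynomial.natDegree_le_of_degree_le this
  · intro i _ k hk
    exact Lagrange.eval_interpolate_at_node _ hinj (Finset.mem_range.2 (by omega))
  · intro i hi x hx
    exact (hM i x hx).trans ((le_abs_self _).trans
      (Finset.single_le_sum (f := fun i => |M i|) (fun i _ => abs_nonneg _)
        (Finset.mem_range.2 hi)))

/-- A function that is orthogonal to the polynomials of degree less than `p` and differs from `w`
by a step function on the uniform subdivision is bounded by `w`, uniformly in the interval: the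
values of the step function are recovered by testing with the dual polynomials. -/
lemma exists_step_bound (p : ℕ) (hp : 1 ≤ p) : ∃ M : ℝ, 0 ≤ M ∧ ∀ (a b : ℝ), a < b →
    ∀ (e w : ℝ → ℝ) (s : ℕ → ℝ) (W : ℝ), Continuous w → (∀ x ∈ Set.Icc a b, |w x| ≤ W) →
      (∀ x y, IntervalIntegrable e volume x y) →
      (∀ i < p, ∀ x ∈ Set.Ico (equiNode p a b i) (equiNode p a b (i + 1)), e x = w x - s i) →
      (∀ q : Polynomial ℝ, q.natDegree < p → ∫ x in a..b, e x * q.eval x = 0) →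
      ∀ x ∈ Set.Ico a b, |e x| ≤ (1 + M) * W := by
  obtain ⟨Q, M, hM0, hQ1, hQ2, hQ3⟩ := exists_stepPoly p hp
  refine ⟨M, hM0, fun a b hab e w s W hw hW he hes horth => ?_⟩
  set τ := equiNode p a b with hτ
  have hh : 0 < b - a := by linarith
  have hs : ∀ i < p, |s i| ≤ M * W := by
    intro i hi
    -- the step polynomial transplanted to `[a, b]`
    set R : Polynomial ℝ := (Q i).comp (.C (b - a)⁻¹ * (.X - .C a)) with hR
    have hRd : R.derivative.natDegree < p := by
      have h1 : R.natDegree ≤ p := by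
        refine (Polynomial.natDegree_comp_le).trans ?_
        have h2 : (Polynomial.C (b - a)⁻¹ * (.X - .C a)).natDegree ≤ 1 := by
          refine (Polynomial.natDegree_C_mul_le _ _).trans ?_
          rw [Polynomial.natDegree_X_sub_C]
        calc _ ≤ p * 1 := Nat.mul_le_mul (hQ1 i hi) h2
          _ = p := mul_one p
      rcases Nat.eq_zero_or_pos R.natDegree with h0 | h0
      · rw [Polynomial.derivative_of_natDegree_zero h0, Polynomial.natDegree_zero]; omega
      · exact (Polynomial.natDegree_derivative_lt h0.ne').trans_le h1
    have hRτ : ∀ k ≤ p, R.eval (τ k) = if k ≤ i then 0 else 1 := by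
      intro k hk
      rw [← hQ2 i hi k hk, hR, Polynomial.eval_comp]
      congr 1
      simp only [Polynomial.eval_mul, Polynomial.eval_C, Polynomial.eval_sub, Polynomial.eval_X,
        hτ, equiNode]
      field_simp
      ring
    have hRb : ∀ x ∈ Set.Icc a b, |R.derivative.eval x| ≤ M * (b - a)⁻¹ := by
      intro x hx
      have hmem : (b - a)⁻¹ * (x - a) ∈ Set.Icc (0 : ℝ) 1 := by
        have h1 : 0 ≤ x - a := by linarith [hx.1]
        refine ⟨by positivity, ?_⟩
        rw [inv_mul_le_one₀ hh]; linarith [hx.2]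
      have h3 := hQ3 i hi _ hmem
      rw [hR, Polynomial.derivative_comp]
      simp only [Polynomial.eval_mul, Polynomial.eval_comp, Polynomial.eval_C, Polynomial.eval_sub,
        Polynomial.eval_X, Polynomial.derivative_mul, Polynomial.derivative_C, zero_mul, zero_add,
        Polynomial.derivative_sub, Polynomial.derivative_X, sub_zero, mul_one]
      rw [abs_mul, abs_of_pos (inv_pos.2 hh), mul_comm]
      gcongr
    set q : ℝ → ℝ := fun x => R.derivative.eval x with hq
    have hqc : Continuous q := Polynomial.continuous _
    have hqd : ∀ x y, ∫ z in x..y, q z = R.eval y - R.eval x := fun x y =>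
      intervalIntegral.integral_eq_sub_of_hasDerivAt (fun z _ => R.hasDerivAt z)
        (hqc.intervalIntegrable x y)
    have hsplit : ∀ f : ℝ → ℝ, (∀ x y, IntervalIntegrable f volume x y) →
        ∫ x in a..b, f x = ∑ k ∈ Finset.range p, ∫ x in τ k..τ (k + 1), f x := by
      intro f hf
      rw [intervalIntegral.sum_integral_adjacent_intervals (fun k _ => hf _ _)]
      rw [hτ, equiNode_zero, equiNode_self hp]
    have hwq : ∀ x y, IntervalIntegrable (fun x => w x * q x) volume x y := fun x y =>
      (hw.mul hqc).intervalIntegrable x y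
    have heq : ∀ x y, IntervalIntegrable (fun x => e x * q x) volume x y := fun x y =>
      (he x y).mul_continuousOn hqc.continuousOn
    have hsub : ∀ k < p, ∫ x in τ k..τ (k + 1), e x * q x =
        (∫ x in τ k..τ (k + 1), w x * q x) - s k * (R.eval (τ (k + 1)) - R.eval (τ k)) := by
      intro k hk
      have hle : τ k ≤ τ (k + 1) := (equiNode_lt hp hab (Nat.lt_succ_self k)).le
      rw [← hqd, ← intervalIntegral.integral_const_mul, ← intervalIntegral.integral_sub (hwq _ _)
        ((hqc.intervalIntegrable _ _).const_mul _), ← integral_Ioo_eq_interval hle,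
        ← integral_Ioo_eq_interval hle]
      refine setIntegral_congr_fun measurableSet_Ioo fun x hx => ?_
      rw [hes k hk x ⟨hx.1.le, hx.2⟩]; ring
    have h0 := horth R.derivative hRd
    rw [hsplit _ heq, Finset.sum_congr rfl fun k hk => hsub k (Finset.mem_range.1 hk),
      Finset.sum_sub_distrib, ← hsplit _ hwq] at h0
    have hsum : ∑ k ∈ Finset.range p, s k * (R.eval (τ (k + 1)) - R.eval (τ k)) = s i := by
      rw [Finset.sum_eq_single_of_mem i (Finset.mem_range.2 hi)]
      · rw [hRτ _ (by omega), hRτ _ hi.le, if_neg (by omega), if_pos le_rfl]; ring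
      · intro k hk hki
        rw [Finset.mem_range] at hk
        rw [hRτ _ (by omega), hRτ _ hk.le]
        by_cases h1 : k < i
        · rw [if_pos (by omega), if_pos (by omega)]; ring
        · rw [if_neg (by omega), if_neg (by omega)]; ring
    rw [hsum] at h0
    have hsi : s i = ∫ x in a..b, w x * q x := by linarith
    have hnorm := intervalIntegral.norm_integral_le_of_norm_le_const (a := a) (b := b)
      (f := fun x => w x * q x) (C := W * (M * (b - a)⁻¹)) ?_
    · rw [hsi]
      refine hnorm.trans (le_of_eq ?_)
      rw [abs_of_pos hh]
      field_simp
    · intro x hx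
      rw [Set.uIoc_of_le hab.le] at hx
      have hx' : x ∈ Set.Icc a b := ⟨hx.1.le, hx.2⟩
      rw [norm_mul]
      exact mul_le_mul (hW x hx') (hRb x hx') (norm_nonneg _)
        ((abs_nonneg _).trans (hW x hx'))
  intro x hx
  obtain ⟨i, hi, hxi⟩ : ∃ i < p, x ∈ Set.Ico (τ i) (τ (i + 1)) := by
    classical
    have hex : ∃ k, x < τ k := ⟨p, by rw [hτ, equiNode_self hp]; exact hx.2⟩
    have hspec := Nat.find_spec hex
    have hne : Nat.find hex ≠ 0 := by
      intro h
      rw [h, hτ, equiNode_zero] at hspec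
      exact absurd hx.1 (not_le.2 hspec)
    have hle : Nat.find hex ≤ p := Nat.find_min' hex (by rw [hτ, equiNode_self hp]; exact hx.2)
    refine ⟨Nat.find hex - 1, by omega, ?_, ?_⟩
    · exact not_lt.1 (Nat.find_min hex (by omega))
    · rwa [Nat.sub_add_cancel (by omega)]
  rw [hes i hi x hxi]
  calc |w x - s i| ≤ |w x| + |s i| := abs_sub _ _
    _ ≤ W + M * W := add_le_add (hW x ⟨hx.1, hx.2.le⟩) (hs i hi)
    _ = (1 + M) * W := by ring

/-! ### Hermite interpolation on one element -/

lemma plusPow_zero_intervalIntegrable (τ x y : ℝ) :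
    IntervalIntegrable (fun x => plusPow 0 (x - τ)) volume x y := by
  have hm : Measurable (fun x : ℝ => plusPow 0 (x - τ)) := by
    unfold plusPow
    exact Measurable.ite (measurableSet_lt (by fun_prop) (by fun_prop)) (by fun_prop) (by fun_prop)
  refine (intervalIntegrable_const (c := (1 : ℝ))).mono_fun hm.aestronglyMeasurable ?_
  refine Eventually.of_forall fun z => ?_
  simp only [plusPow, pow_zero]
  split_ifs <;> simp

lemma rightChain_locSpline (p : ℕ) (τ α c : ℕ → ℝ) : RightChain p (locSpline p τ α c) where
  deriv _ hk x := locSpline_hasDerivWithinAt hk τ α c x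
  cont _ hk := continuous_locSpline hk τ α c
  integrable x y := by
    unfold locSpline
    simp only [Nat.sub_self]
    refine IntervalIntegrable.add ?_ ?_
    · refine Continuous.intervalIntegrable ?_ x y
      fun_prop
    · have := IntervalIntegrable.sum (μ := volume) (a := x) (b := y) (Finset.range p)
        (f := fun i x => c i * (p.descFactorial p * plusPow 0 (x - τ i)))
        fun i _ => ((plusPow_zero_intervalIntegrable (τ i) x y).const_mul _).const_mul _
      simpa only [Finset.sum_fn] using this

lemma locSpline_top {p : ℕ} (hp : 1 ≤ p) {a b : ℝ} (hab : a < b) (α c : ℕ → ℝ) {i : ℕ} (hi : i < p)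
    {x : ℝ} (hx : x ∈ Set.Ico (equiNode p a b i) (equiNode p a b (i + 1))) :
    locSpline p (equiNode p a b) α c p x =
      p.factorial * ∑ k ∈ Finset.range (i + 1), c k := by
  unfold locSpline
  rw [Finset.sum_eq_zero, zero_add, Finset.mul_sum]
  · rw [← Finset.sum_subset (Finset.range_mono (by omega : i + 1 ≤ p))]
    · refine Finset.sum_congr rfl fun k hk => ?_
      rw [Finset.mem_range] at hk
      rw [plusPow_of_nonneg]
      · rw [Nat.descFactorial_self]; simp [mul_comm]
      · linarith [equiNode_mono hp hab (by omega : k ≤ i), hx.1]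
    · intro k _ hk
      rw [Finset.mem_range] at hk
      rw [plusPow_of_neg]
      · simp
      · linarith [equiNode_mono hp hab (by omega : i + 1 ≤ k), hx.2]
  · intro k hk
    rw [Nat.descFactorial_of_lt (Finset.mem_range.1 hk)]; simp

/-- A local spline with zero Hermite data at both end points vanishes. -/
lemma locSpline_coeff_eq_zero {p : ℕ} (hp : 1 ≤ p) {a b : ℝ} (hab : a < b) {α c : ℕ → ℝ}
    (ha : ∀ l < p, locSpline p (equiNode p a b) α c l a = 0)
    (hb : ∀ l < p, locSpline p (equiNode p a b) α c l b = 0) :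
    ∀ k < p, α k = 0 ∧ c k = 0 := by
  obtain ⟨M, -, hM⟩ := exists_step_bound p hp
  have hchain := rightChain_locSpline p (equiNode p a b) α c
  have hz := hM a b hab (locSpline p (equiNode p a b) α c p) (fun _ => 0)
    (fun i => - (p.factorial * ∑ k ∈ Finset.range (i + 1), c k)) 0 continuous_const (by simp)
    hchain.integrable (fun i hi x hx => by rw [locSpline_top hp hab α c hi hx]; ring)
    (fun q hq => hchain.integral_mul_polynomial ha hb hq)
  have hf : ∀ l : ℕ, (l.factorial : ℝ) ≠ 0 := fun l => by exact_mod_cast l.factorial_ne_zero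
  have hsum : ∀ i ≤ p, ∑ k ∈ Finset.range i, c k = 0 := by
    intro i hi
    rcases i with _ | i
    · simp
    · have hx : equiNode p a b i ∈ Set.Ico (equiNode p a b i) (equiNode p a b (i + 1)) :=
        ⟨le_rfl, equiNode_lt hp hab (Nat.lt_succ_self i)⟩
      have h1 : equiNode p a b i ∈ Set.Ico a b := by
        refine ⟨?_, ?_⟩
        · have := equiNode_mono hp hab (Nat.zero_le i); rwa [equiNode_zero] at this
        · have := equiNode_lt hp hab (Nat.lt_of_succ_le hi); rwa [equiNode_self hp] at this
      have h2 := hz _ h1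
      rw [locSpline_top hp hab α c (by omega) hx, mul_zero, abs_nonpos_iff] at h2
      exact (mul_eq_zero.1 h2).resolve_left (hf p)
  intro k hk
  constructor
  · have h1 := locSpline_left hk (τ := equiNode p a b)
      (fun i _ => equiNode_mono hp hab (Nat.zero_le i)) α c
    rw [equiNode_zero, ha k hk] at h1
    exact (mul_eq_zero.1 h1.symm).resolve_right (hf k)
  · have h1 := hsum (k + 1) (by omega)
    rwa [Finset.sum_range_succ, hsum k hk.le, zero_add] at h1

/-- Extension of a finite sequence by zero. -/
noncomputable def extendZero (p : ℕ) : (Fin p → ℝ) →ₗ[ℝ] (ℕ → ℝ) where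
  toFun v k := if h : k < p then v ⟨k, h⟩ else 0
  map_add' v w := by
    ext k; simp only [Pi.add_apply]; split_ifs <;> simp
  map_smul' y v := by
    ext k; simp only [Pi.smul_apply, RingHom.id_apply]; split_ifs <;> simp

/-- Hermite interpolation by local splines: the numbers of coefficients and of conditions agree,
so that uniqueness gives existence. -/
lemma exists_locSpline_hermite {p : ℕ} (hp : 1 ≤ p) {a b : ℝ} (hab : a < b) (A B : ℕ → ℝ) :
    ∃ α c : ℕ → ℝ, ∀ l < p, locSpline p (equiNode p a b) α c l a = A l ∧
      locSpline p (equiNode p a b) α c l b = B l := by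
  let T : (Fin p → ℝ) × (Fin p → ℝ) →ₗ[ℝ] (Fin p → ℝ) × (Fin p → ℝ) :=
    { toFun := fun v =>
        (fun l => locSpline p (equiNode p a b) (extendZero p v.1) (extendZero p v.2) l a,
          fun l => locSpline p (equiNode p a b) (extendZero p v.1) (extendZero p v.2) l b)
      map_add' := fun v w => by
        ext l <;> simp [locSpline_add]
      map_smul' := fun y v => by
        ext l <;> simp [locSpline_smul] }
  have hinj : Function.Injective T := by
    rw [← LinearMap.ker_eq_bot, LinearMap.ker_eq_bot']
    intro v hv
    have h1 : ∀ l : Fin p, _ = (0 : ℝ) := fun l => congrFun (congrArg Prod.fst hv) l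
    have h2 : ∀ l : Fin p, _ = (0 : ℝ) := fun l => congrFun (congrArg Prod.snd hv) l
    have hz := locSpline_coeff_eq_zero hp hab (α := extendZero p v.1) (c := extendZero p v.2)
      (fun l hl => h1 ⟨l, hl⟩) (fun l hl => h2 ⟨l, hl⟩)
    ext l
    · have := (hz l l.2).1; simpa [extendZero] using this
    · have := (hz l l.2).2; simpa [extendZero] using this
  obtain ⟨v, hv⟩ := LinearMap.injective_iff_surjective.1 hinj (fun l => A l, fun l => B l)
  refine ⟨extendZero p v.1, extendZero p v.2, fun l hl => ⟨?_, ?_⟩⟩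
  · exact congrFun (congrArg Prod.fst hv) ⟨l, hl⟩
  · exact congrFun (congrArg Prod.snd hv) ⟨l, hl⟩

/-- The error of Hermite interpolation on one element. -/
lemma exists_element_estimate (p : ℕ) (hp : 1 ≤ p) : ∃ C : ℝ≥0, ∀ (a b : ℝ), a < b →
    ∀ (U : ℕ → ℝ → ℝ) (g : ℝ → ℝ) (α c : ℕ → ℝ),
      (∀ k < p, ∀ x, HasDerivAt (U k) (U (k + 1) x) x) → Continuous (U p) →
      MemLp g 2 (volume.restrict (Set.Ioo a b)) →
      (∀ x ∈ Set.Icc a b, U p x - U p a = ∫ y in a..x, g y) →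
      (∀ l < p, locSpline p (equiNode p a b) α c l a = U l a) →
      (∀ l < p, locSpline p (equiNode p a b) α c l b = U l b) →
      ∀ l ≤ p, eLpNorm (fun x => U l x - locSpline p (equiNode p a b) α c l x) 2
          (volume.restrict (Set.Ioo a b)) ≤
        C * ENNReal.ofReal (b - a) ^ (p + 1 - l) * eLpNorm g 2 (volume.restrict (Set.Ioo a b)) := by
  obtain ⟨M, hM0, hM⟩ := exists_step_bound p hp
  refine ⟨(1 + M).toNNReal, fun a b hab U g α c hU1 hU2 hg hUg ha hb l hl => ?_⟩
  set μ := volume.restrict (Set.Ioo a b) with hμ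
  have hh : 0 < b - a := by linarith
  have hμu : μ Set.univ = ENNReal.ofReal (b - a) := by
    rw [hμ, Measure.restrict_apply_univ, Real.volume_Ioo]
  have hfin : IsFiniteMeasure μ := ⟨by rw [hμu]; exact ENNReal.ofReal_lt_top⟩
  have hg1 : Integrable g μ := hg.integrable (by norm_num)
  set W : ℝ := ∫ x in Set.Ioo a b, |g x| with hW
  have hW0 : 0 ≤ W := integral_nonneg fun x => abs_nonneg _
  -- Hölder's inequality
  have hWg : ENNReal.ofReal W ≤ eLpNorm g 2 μ * ENNReal.ofReal (b - a) ^ (1 / 2 : ℝ) := by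
    have h1 := eLpNorm_le_eLpNorm_mul_rpow_measure_univ (μ := μ) (p := 1) (q := 2) (f := g)
      (by norm_num) hg.1
    rw [hμu] at h1
    have h2 : ENNReal.ofReal W = eLpNorm g 1 μ := by
      rw [eLpNorm_one_eq_lintegral_enorm, hW, ← hμ,
        ← ofReal_integral_norm_eq_lintegral_enorm hg1]
      rfl
    rw [h2]
    convert h1 using 3
    norm_num
  have hwW : ∀ x ∈ Set.Icc a b, |U p x - U p a| ≤ W := by
    intro x hx
    rw [hUg x hx, intervalIntegral.integral_of_le hx.1, integral_Ioc_eq_integral_Ioo,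
      ← Real.norm_eq_abs]
    refine (norm_integral_le_integral_norm _).trans ?_
    exact setIntegral_mono_set hg1.norm (ae_of_all _ fun x => norm_nonneg _)
      (Set.Ioo_subset_Ioo_right hx.2).eventuallyLE
  have hchain : RightChain p (fun l x => U l x - locSpline p (equiNode p a b) α c l x) :=
    (rightChain_of_hasDerivAt hU1 hU2).sub (rightChain_locSpline p _ α c)
  have ha' : ∀ k < p, U k a - locSpline p (equiNode p a b) α c k a = 0 := fun k hk => by
    rw [ha k hk, sub_self]
  have hb' : ∀ k < p, U k b - locSpline p (equiNode p a b) α c k b = 0 := fun k hk => by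
    rw [hb k hk, sub_self]
  have hbound := hM a b hab _ (fun x => U p x - U p a)
    (fun i => p.factorial * ∑ k ∈ Finset.range (i + 1), c k - U p a) W (hU2.sub continuous_const)
    hwW hchain.integrable (fun i hi x hx => by rw [locSpline_top hp hab α c hi hx]; ring)
    (fun q hq => hchain.integral_mul_polynomial ha' hb' hq)
  have hl' := hchain.abs_le ha' hbound (Nat.sub_le p l)
  rw [Nat.sub_sub_self hl] at hl'
  have hE : eLpNorm (fun x => U l x - locSpline p (equiNode p a b) α c l x) 2 μ ≤
      ENNReal.ofReal (b - a) ^ (1 / 2 : ℝ) *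
        ENNReal.ofReal ((b - a) ^ (p - l) * ((1 + M) * W)) := by
    have h1 := eLpNorm_le_of_ae_bound (μ := μ) (p := 2)
      (f := fun x => U l x - locSpline p (equiNode p a b) α c l x)
      (C := (b - a) ^ (p - l) * ((1 + M) * W)) ?_
    · rw [hμu] at h1
      convert h1 using 3
      norm_num
    · filter_upwards [ae_restrict_mem measurableSet_Ioo] with x hx
        using hl' x ⟨hx.1.le, hx.2⟩
  refine hE.trans ?_
  have hC : ((1 + M).toNNReal : ℝ≥0∞) = ENNReal.ofReal (1 + M) := rfl
  rw [hC, ENNReal.ofReal_mul (by positivity), ENNReal.ofReal_mul (by linarith),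
    ENNReal.ofReal_pow hh.le, show p + 1 - l = (p - l) + 1 by omega, pow_succ]
  have hhalf : ENNReal.ofReal (b - a) ^ (1 / 2 : ℝ) * ENNReal.ofReal (b - a) ^ (1 / 2 : ℝ) =
      ENNReal.ofReal (b - a) := by
    rw [← ENNReal.rpow_add _ _ (by simpa using hab) ENNReal.ofReal_ne_top]
    norm_num
  calc ENNReal.ofReal (b - a) ^ (1 / 2 : ℝ) * (ENNReal.ofReal (b - a) ^ (p - l) *
        (ENNReal.ofReal (1 + M) * ENNReal.ofReal W))
      ≤ ENNReal.ofReal (b - a) ^ (1 / 2 : ℝ) * (ENNReal.ofReal (b - a) ^ (p - l) *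
        (ENNReal.ofReal (1 + M) * (eLpNorm g 2 μ * ENNReal.ofReal (b - a) ^ (1 / 2 : ℝ)))) := by
        gcongr
    _ = ENNReal.ofReal (1 + M) * (ENNReal.ofReal (b - a) ^ (p - l) *
        (ENNReal.ofReal (b - a) ^ (1 / 2 : ℝ) * ENNReal.ofReal (b - a) ^ (1 / 2 : ℝ))) *
          eLpNorm g 2 μ := by ring
    _ = _ := by rw [hhalf]

section Interpolant

variable {p n : ℕ} {ξ : ℕ → ℝ} {r : ℕ → ℕ}

/-! ### Piecewise definitions -/

lemma continuous_ite_lt {f g : ℝ → ℝ} {a : ℝ} (hf : Continuous f) (hg : Continuous g)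
    (h : f a = g a) : Continuous (fun x => if x < a then f x else g x) := by
  have : (fun x => if x < a then f x else g x) = fun x => if a ≤ x then g x else f x := by
    ext x
    by_cases hx : x < a
    · rw [if_pos hx, if_neg (not_le.2 hx)]
    · rw [if_neg hx, if_pos (not_lt.1 hx)]
  rw [this]
  exact Continuous.if_le hg hf continuous_const continuous_id fun x hx => by
    have hx' : a = x := hx
    rw [← hx', h]

/-- Two smooth functions with the same derivatives up to order `m` at `a` glue to a function of
class `C^m`. -/
lemma contDiff_glue {f g : ℕ → ℝ → ℝ} {m : ℕ} {a : ℝ}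
    (hf : ∀ k < m, ∀ x, HasDerivAt (f k) (f (k + 1) x) x) (hfc : Continuous (f m))
    (hg : ∀ k < m, ∀ x, HasDerivAt (g k) (g (k + 1) x) x) (hgc : Continuous (g m))
    (h : ∀ k ≤ m, f k a = g k a) :
    ContDiff ℝ m (fun x => if x < a then f 0 x else g 0 x) ∧
      ∀ k ≤ m, iteratedDeriv k (fun x => if x < a then f 0 x else g 0 x) a = g k a := by
  set G : ℕ → ℝ → ℝ := fun k x => if x < a then f k x else g k x with hG
  have hchain : ∀ k < m, ∀ x, HasDerivAt (G k) (G (k + 1) x) x := by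
    intro k hk x
    rcases lt_trichotomy x a with hx | rfl | hx
    · simp only [hG, if_pos hx]
      refine (hf k hk x).congr_of_eventuallyEq ?_
      filter_upwards [gt_mem_nhds hx] with y hy using if_pos hy
    · simp only [hG, lt_irrefl, if_false]
      refine hasDerivAt_ite_lt (h k hk.le) ?_ (hg k hk x)
      rw [← h (k + 1) hk]
      exact hf k hk x
    · simp only [hG, if_neg (not_lt.2 hx.le)]
      refine (hg k hk x).congr_of_eventuallyEq ?_
      filter_upwards [lt_mem_nhds hx] with y hy using if_neg (not_lt.2 hy.le)
  refine ⟨contDiff_chain hchain (continuous_ite_lt hfc hgc (h m le_rfl)), fun k hk => ?_⟩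
  have := congrFun (iteratedDeriv_chain hchain hk) a
  simpa [hG] using this

lemma IsOpenKnots.sum_indicator_of_mem (h : IsOpenKnots p n ξ r) (f : ℕ → ℝ → ℝ) {j : ℕ}
    (hj : j < n) {x : ℝ} (hx : x ∈ Set.Ico (ξ j) (ξ (j + 1))) :
    ∑ i ∈ Finset.range n, (Set.Ico (ξ i) (ξ (i + 1))).indicator (f i) x = f j x := by
  rw [Finset.sum_eq_single_of_mem j (Finset.mem_range.2 hj), Set.indicator_of_mem hx]
  intro i hi hij
  rw [Finset.mem_range] at hi
  apply Set.indicator_of_notMem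
  intro hx'
  rcases lt_or_gt_of_ne hij with hlt | hlt
  · have := h.breakpoint_le (Nat.succ_le_of_lt hlt) hj.le
    simp only [Nat.succ_eq_add_one] at this
    linarith [hx'.2, hx.1]
  · have := h.breakpoint_le (Nat.succ_le_of_lt hlt) hi.le
    simp only [Nat.succ_eq_add_one] at this
    linarith [hx'.1, hx.2]

lemma IsOpenKnots.sum_indicator_of_notMem (h : IsOpenKnots p n ξ r) (f : ℕ → ℝ → ℝ)
    {x : ℝ} (hx : ¬ (ξ 0 ≤ x ∧ x < ξ n)) :
    ∑ i ∈ Finset.range n, (Set.Ico (ξ i) (ξ (i + 1))).indicator (f i) x = 0 := by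
  refine Finset.sum_eq_zero fun i hi => Set.indicator_of_notMem (fun hx' => hx ?_) _
  rw [Finset.mem_range] at hi
  exact ⟨(h.breakpoint_le (Nat.zero_le i) hi.le).trans hx'.1,
    hx'.2.trans_le (h.breakpoint_le (by omega) le_rfl)⟩

lemma exists_mem_Ico_breakpoints {x : ℝ} (hx : ξ 0 ≤ x ∧ x < ξ n) :
    ∃ j < n, x ∈ Set.Ico (ξ j) (ξ (j + 1)) := by
  by_contra hne
  push Not at hne
  have : ∀ k ≤ n, ξ k ≤ x := by
    intro k hk
    induction k with
    | zero => exact hx.1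
    | succ k ih =>
      have h1 := ih (by omega)
      by_contra h2
      exact hne k (by omega) ⟨h1, not_le.1 h2⟩
  exact absurd hx.2 (not_lt.2 (this n le_rfl))

/-! ### Existence and uniqueness of the Hermite interpolant -/

/-- The representation of `u` on each element by a chain of derivatives on the line. -/
lemma MemBrokenSobolev.exists_chain (h : IsOpenKnots p n ξ r) {u : ℝ → ℝ}
    (hu : MemBrokenSobolev p n ξ r u) {j : ℕ} (hj : j < n) :
    ∃ (U : ℕ → ℝ → ℝ) (g : ℝ → ℝ), (∀ k < p, ∀ x, HasDerivAt (U k) (U (k + 1) x) x) ∧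
      Continuous (U p) ∧ Set.EqOn u (U 0) (element ξ j) ∧
      HasWeakDeriv (p + 1) u g (element ξ j) ∧ MemLp g 2 (volume.restrict (element ξ j)) ∧
      ∀ x ∈ Set.Icc (ξ j) (ξ (j + 1)), U p x - U p (ξ j) = ∫ y in (ξ j)..x, g y :=
  (hu.1 j hj).2.exists_chain (h.lt_succ j hj) (hu.1 j hj).1

/-- At an interior breakpoint the one-sided limits of derivatives agree also for the orders where
the interpolation condition is two-sided. -/
lemma IsHermiteInterpolant.sameDerivLimit (h : IsOpenKnots p n ξ r) {u s : ℝ → ℝ}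
    (hu : MemBrokenSobolev p n ξ r u) (hs : IsHermiteInterpolant p n ξ r u s) {j l : ℕ}
    (hj : j < n) (hl : l < p) :
    SameDerivLimit l s u (𝓝[>] (ξ j)) ∧ SameDerivLimit l s u (𝓝[<] (ξ (j + 1))) := by
  have hs' := mem_pieceSpace.1 (h.splineSpace_eq_pieceSpace ▸ hs.mem)
  have key : ∀ i, 0 < i → i < n →
      SameDerivLimit l s u (𝓝[<] (ξ i)) ∧ SameDerivLimit l s u (𝓝[>] (ξ i)) := by
    intro i hi0 hi
    rcases le_or_gt l (p - r i) with hle | hgt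
    · have h1 := (continuousAt_iteratedDeriv (hs'.2.2 i hi0 hi) hle).tendsto
      have h2 := (continuousAt_iteratedDeriv (hu.2 i hi0 hi) hle).tendsto
      rw [hs.twoSided i hi0 hi l hle] at h1
      exact ⟨⟨_, h1.mono_left nhdsWithin_le_nhds, h2.mono_left nhdsWithin_le_nhds⟩,
        ⟨_, h1.mono_left nhdsWithin_le_nhds, h2.mono_left nhdsWithin_le_nhds⟩⟩
    · exact hs.oneSided i hi0 hi l hgt (by omega)
  constructor
  · rcases Nat.eq_zero_or_pos j with rfl | h0
    · exact hs.first l (by omega)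
    · exact (key j h0 hj).2
  · rcases Nat.lt_or_ge (j + 1) n with h1 | h1
    · exact (key (j + 1) (by omega) h1).1
    · rw [show j + 1 = n by omega]
      exact hs.last l (by omega)

/-- The local splines of a Hermite interpolant have the Hermite data of `u`. -/
lemma IsHermiteInterpolant.locSpline_eq (h : IsOpenKnots p n ξ r) {u s : ℝ → ℝ}
    (hu : MemBrokenSobolev p n ξ r u) (hs : IsHermiteInterpolant p n ξ r u s) {j : ℕ}
    (hj : j < n) {U : ℕ → ℝ → ℝ} (hU : ∀ k < p, ∀ x, HasDerivAt (U k) (U (k + 1) x) x)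
    (hUc : Continuous (U p)) (hUu : Set.EqOn u (U 0) (element ξ j)) {α c : ℕ → ℝ}
    (hαc : ∀ x ∈ Set.Ico (ξ j) (ξ (j + 1)), s x = locSpline p (subKnot p ξ j) α c 0 x)
    {l : ℕ} (hl : l < p) :
    locSpline p (subKnot p ξ j) α c l (ξ j) = U l (ξ j) ∧
      locSpline p (subKnot p ξ j) α c l (ξ (j + 1)) = U l (ξ (j + 1)) := by
  have hlt := h.lt_succ j hj
  have hEq : Set.EqOn s (locSpline p (subKnot p ξ j) α c 0) (Set.Ioo (ξ j) (ξ (j + 1))) :=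
    fun x hx => hαc x ⟨hx.1.le, hx.2⟩
  obtain ⟨⟨y, hy1, hy2⟩, ⟨z, hz1, hz2⟩⟩ := hs.sameDerivLimit h hu hj hl
  have hS := fun k (hk : k < p - 1) => locSpline_hasDerivAt hk (subKnot p ξ j) α c
  have hSc := continuous_locSpline (by omega : p - 1 < p) (subKnot p ξ j) α c
  constructor
  · rw [tendsto_nhds_unique (tendsto_iteratedDeriv_nhdsGT hlt hS hSc hEq (by omega)) hy1,
      tendsto_nhds_unique (tendsto_iteratedDeriv_nhdsGT hlt hU hUc hUu hl.le) hy2]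
  · rw [tendsto_nhds_unique (tendsto_iteratedDeriv_nhdsLT hlt hS hSc hEq (by omega)) hz1,
      tendsto_nhds_unique (tendsto_iteratedDeriv_nhdsLT hlt hU hUc hUu hl.le) hz2]

/-- On each element, two interpolants differ by a local spline with zero Hermite data. -/
lemma IsHermiteInterpolant.unique (h : IsOpenKnots p n ξ r) {u s s' : ℝ → ℝ}
    (hu : MemBrokenSobolev p n ξ r u) (hs : IsHermiteInterpolant p n ξ r u s)
    (hs' : IsHermiteInterpolant p n ξ r u s') : s = s' := by
  have h1 := mem_pieceSpace.1 (h.splineSpace_eq_pieceSpace ▸ hs.mem)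
  have h2 := mem_pieceSpace.1 (h.splineSpace_eq_pieceSpace ▸ hs'.mem)
  ext x
  by_cases hx : ξ 0 ≤ x ∧ x < ξ n
  · obtain ⟨j, hj, hxj⟩ := exists_mem_Ico_breakpoints hx
    obtain ⟨U, g, hU, hUc, hUu, -⟩ := hu.exists_chain h hj
    obtain ⟨α, c, hαc⟩ := h1.2.1 j hj
    obtain ⟨α', c', hαc'⟩ := h2.2.1 j hj
    have e1 := fun l (hl : l < p) => hs.locSpline_eq h hu hj hU hUc hUu hαc hl
    have e2 := fun l (hl : l < p) => hs'.locSpline_eq h hu hj hU hUc hUu hαc' hl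
    have hz := locSpline_coeff_eq_zero h.degree_pos (h.lt_succ j hj)
      (α := α + (-1 : ℝ) • α') (c := c + (-1 : ℝ) • c')
      (fun l hl => by
        rw [locSpline_add, locSpline_smul]
        have := (e1 l hl).1.trans (e2 l hl).1.symm
        change locSpline p (subKnot p ξ j) α c l (ξ j) +
          -1 * locSpline p (subKnot p ξ j) α' c' l (ξ j) = 0
        rw [this]; ring)
      (fun l hl => by
        rw [locSpline_add, locSpline_smul]
        have := (e1 l hl).2.trans (e2 l hl).2.symm
        change locSpline p (subKnot p ξ j) α c l (ξ (j + 1)) +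
          -1 * locSpline p (subKnot p ξ j) α' c' l (ξ (j + 1)) = 0
        rw [this]; ring)
    rw [hαc x hxj, hαc' x hxj, locSpline_zero, locSpline_zero]
    congr 1 <;> refine Finset.sum_congr rfl fun k hk => ?_
    · have := (hz k (Finset.mem_range.1 hk)).1
      simp only [Pi.add_apply, Pi.smul_apply, smul_eq_mul] at this
      rw [show α k = α' k by linarith]
    · have := (hz k (Finset.mem_range.1 hk)).2
      simp only [Pi.add_apply, Pi.smul_apply, smul_eq_mul] at this
      rw [show c k = c' k by linarith]
  · rw [h1.1 x hx, h2.1 x hx]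

/-- The local interpolants on the elements fit together: at an interior breakpoint their derivatives
of order at most `p - r j` agree with those of `u`, hence with each other. -/
lemma exists_isHermiteInterpolant (h : IsOpenKnots p n ξ r) {u : ℝ → ℝ}
    (hu : MemBrokenSobolev p n ξ r u) : ∃ s, IsHermiteInterpolant p n ξ r u s := by
  have hp := h.degree_pos
  choose! U g hU hUc hUu _ _ _ using fun j (hj : j < n) => hu.exists_chain h hj
  choose! α c hH using fun j (hj : j < n) =>
    exists_locSpline_hermite hp (h.lt_succ j hj) (fun l => U j l (ξ j))
      (fun l => U j l (ξ (j + 1)))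
  set S : ℕ → ℕ → ℝ → ℝ := fun j l => locSpline p (subKnot p ξ j) (α j) (c j) l with hSdef
  have hHL : ∀ j < n, ∀ l < p, S j l (ξ j) = U j l (ξ j) := fun j hj l hl => (hH j hj l hl).1
  have hHR : ∀ j < n, ∀ l < p, S j l (ξ (j + 1)) = U j l (ξ (j + 1)) :=
    fun j hj l hl => (hH j hj l hl).2
  have hS : ∀ j, ∀ k < p - 1, ∀ x, HasDerivAt (S j k) (S j (k + 1) x) x :=
    fun j k hk x => locSpline_hasDerivAt hk _ _ _ x
  have hSc : ∀ j, ∀ k < p, Continuous (S j k) := fun j k hk => continuous_locSpline hk _ _ _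
  set s : ℝ → ℝ := fun x =>
    ∑ i ∈ Finset.range n, (Set.Ico (ξ i) (ξ (i + 1))).indicator (S i 0) x with hs
  have hsI : ∀ j < n, ∀ x ∈ Set.Ico (ξ j) (ξ (j + 1)), s x = S j 0 x := fun j hj x hx =>
    h.sum_indicator_of_mem (fun i => S i 0) hj hx
  have hsE : ∀ j < n, Set.EqOn s (S j 0) (Set.Ioo (ξ j) (ξ (j + 1))) := fun j hj x hx =>
    hsI j hj x ⟨hx.1.le, hx.2⟩
  have hlimR : ∀ j < n, ∀ l < p, SameDerivLimit l s u (𝓝[>] (ξ j)) := by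
    intro j hj l hl
    refine ⟨U j l (ξ j), ?_, tendsto_iteratedDeriv_nhdsGT (h.lt_succ j hj) (hU j hj) (hUc j hj)
      (hUu j hj) hl.le⟩
    rw [← hHL j hj l hl]
    exact tendsto_iteratedDeriv_nhdsGT (h.lt_succ j hj) (hS j) (hSc j (p - 1) (by omega))
      (hsE j hj) (by omega)
  have hlimL : ∀ j < n, ∀ l < p, SameDerivLimit l s u (𝓝[<] (ξ (j + 1))) := by
    intro j hj l hl
    refine ⟨U j l (ξ (j + 1)), ?_, tendsto_iteratedDeriv_nhdsLT (h.lt_succ j hj) (hU j hj)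
      (hUc j hj) (hUu j hj) hl.le⟩
    rw [← hHR j hj l hl]
    exact tendsto_iteratedDeriv_nhdsLT (h.lt_succ j hj) (hS j) (hSc j (p - 1) (by omega))
      (hsE j hj) (by omega)
  -- at an interior breakpoint `s` is glued from two pieces with matching derivatives
  have hglue : ∀ j, 0 < j → j < n → ContDiffAt ℝ ((p - r j : ℕ) : WithTop ℕ∞) s (ξ j) ∧
      ∀ l ≤ p - r j, iteratedDeriv l s (ξ j) = iteratedDeriv l u (ξ j) := by
    intro j h0 hj
    obtain ⟨i, rfl⟩ : ∃ i, j = i + 1 := ⟨j - 1, by omega⟩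
    have hi : i < n := by omega
    have hr := (h.interior (i + 1) h0 hj).1
    have hcu : ∀ l ≤ p - r (i + 1), Tendsto (iteratedDeriv l u) (𝓝 (ξ (i + 1)))
        (𝓝 (iteratedDeriv l u (ξ (i + 1)))) := fun l hl =>
      (continuousAt_iteratedDeriv (hu.2 (i + 1) h0 hj) hl).tendsto
    have hR : ∀ l ≤ p - r (i + 1), S (i + 1) l (ξ (i + 1)) = iteratedDeriv l u (ξ (i + 1)) := by
      intro l hl
      rw [hHL (i + 1) hj l (by omega)]
      exact tendsto_nhds_unique (tendsto_iteratedDeriv_nhdsGT (h.lt_succ (i + 1) hj)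
        (hU (i + 1) hj) (hUc (i + 1) hj) (hUu (i + 1) hj) (by omega))
        ((hcu l hl).mono_left nhdsWithin_le_nhds)
    have hL : ∀ l ≤ p - r (i + 1), S i l (ξ (i + 1)) = iteratedDeriv l u (ξ (i + 1)) := by
      intro l hl
      rw [hHR i hi l (by omega)]
      exact tendsto_nhds_unique (tendsto_iteratedDeriv_nhdsLT (h.lt_succ i hi)
        (hU i hi) (hUc i hi) (hUu i hi) (by omega))
        ((hcu l hl).mono_left nhdsWithin_le_nhds)
    obtain ⟨hG1, hG2⟩ := contDiff_glue (f := S i) (g := S (i + 1)) (m := p - r (i + 1))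
      (a := ξ (i + 1)) (fun k hk => hS i k (by omega)) (hSc i _ (by omega))
      (fun k hk => hS (i + 1) k (by omega)) (hSc (i + 1) _ (by omega))
      (fun k hk => (hL k hk).trans (hR k hk).symm)
    have hev : s =ᶠ[𝓝 (ξ (i + 1))] fun x => if x < ξ (i + 1) then S i 0 x else S (i + 1) 0 x := by
      filter_upwards [Ioo_mem_nhds (h.lt_succ i hi) (h.lt_succ (i + 1) hj)] with x hx
      by_cases hx' : x < ξ (i + 1)
      · rw [if_pos hx']; exact hsI i hi x ⟨hx.1.le, hx'⟩
      · rw [if_neg hx']; exact hsI (i + 1) hj x ⟨not_lt.1 hx', hx.2⟩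
    refine ⟨hG1.contDiffAt.congr_of_eventuallyEq hev, fun l hl => ?_⟩
    rw [hev.iteratedDeriv_eq, hG2 l hl, hR l hl]
  refine ⟨s, ?_, fun j h0 hj => (hglue j h0 hj).2, ?_, ?_, ?_⟩
  · rw [h.splineSpace_eq_pieceSpace, mem_pieceSpace]
    exact ⟨fun x hx => h.sum_indicator_of_notMem _ hx, fun j hj => ⟨α j, c j, hsI j hj⟩,
      fun j h0 hj => (hglue j h0 hj).1⟩
  · intro j h0 hj l _ hl
    refine ⟨?_, hlimR j hj l (by omega)⟩
    have := hlimL (j - 1) (by omega) l (by omega)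
    rwa [Nat.sub_add_cancel h0] at this
  · intro l hl
    exact hlimR 0 h.elements_pos l (by omega)
  · intro l hl
    have := hlimL (n - 1) (by have := h.elements_pos; omega) l (by omega)
    rwa [Nat.sub_add_cancel h.elements_pos] at this

/-! ### Error estimates -/

/-- On each element the error is represented by a sequence of derivatives that satisfies the local
estimate and integrates by parts without boundary terms. -/
lemma exists_error_chain (p : ℕ) (hp : 1 ≤ p) : ∃ C : ℝ≥0, ∀ (n : ℕ) (ξ : ℕ → ℝ) (r : ℕ → ℕ),
    IsOpenKnots p n ξ r → ∀ u : ℝ → ℝ, MemBrokenSobolev p n ξ r u →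
    ∀ s : ℝ → ℝ, IsHermiteInterpolant p n ξ r u s → ∀ j < n, ∃ E : ℕ → ℝ → ℝ,
      Set.EqOn (u - s) (E 0) (element ξ j) ∧ ∀ l ≤ p, IntegrableOn (E l) (element ξ j) ∧
        (∀ φ : ℝ → ℝ, ContDiff ℝ ∞ φ → ∫ x in element ξ j, E 0 x * iteratedDeriv l φ x =
          (-1) ^ l * ∫ x in element ξ j, E l x * φ x) ∧
        eLpNorm (E l) 2 (volume.restrict (element ξ j)) ≤
          C * ENNReal.ofReal (ξ (j + 1) - ξ j) ^ (p + 1 - l) *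
            seminormH (p + 1) u (element ξ j) := by
  obtain ⟨C, hC⟩ := exists_element_estimate p hp
  refine ⟨C, fun n ξ r h u hu s hs j hj => ?_⟩
  obtain ⟨U, g, hU, hUc, hUu, hg, hg2, hUg⟩ := hu.exists_chain h hj
  obtain ⟨α, c, hαc⟩ := (mem_pieceSpace.1 (h.splineSpace_eq_pieceSpace ▸ hs.mem)).2.1 j hj
  have hd := fun l (hl : l < p) => hs.locSpline_eq h hu hj hU hUc hUu hαc hl
  have hlt := h.lt_succ j hj
  have hchain : RightChain p (fun l x => U l x - locSpline p (subKnot p ξ j) α c l x) :=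
    (rightChain_of_hasDerivAt hU hUc).sub (rightChain_locSpline p _ α c)
  refine ⟨fun l x => U l x - locSpline p (subKnot p ξ j) α c l x, ?_, fun l hl => ⟨?_, ?_, ?_⟩⟩
  · intro x hx
    simp only [Pi.sub_apply]
    rw [hUu hx, hαc x ⟨hx.1.le, hx.2⟩]
  · exact (intervalIntegrable_iff_integrableOn_Ioo_of_le hlt.le).1
      (hchain.intervalIntegrable hl _ _)
  · intro φ hφ
    rw [element, integral_Ioo_eq_interval hlt.le, integral_Ioo_eq_interval hlt.le]
    exact hchain.integral_mul_iteratedDeriv (fun k hk => sub_eq_zero.2 (hd k hk).1.symm)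
      (fun k hk => sub_eq_zero.2 (hd k hk).2.symm) hl hφ
  · rw [show seminormH (p + 1) u (element ξ j) = _ from hg.seminormH_eq]
    exact hC (ξ j) (ξ (j + 1)) hlt U g α c hU hUc hg2 hUg (fun l hl => (hd l hl).1)
      (fun l hl => (hd l hl).2) l hl

lemma IsOpenKnots.restrict_eq_sum (h : IsOpenKnots p n ξ r) :
    volume.restrict (Set.Ioo (ξ 0) (ξ n)) =
      ∑ j ∈ Finset.range n, volume.restrict (element ξ j) := by
  have : ∀ m ≤ n, volume.restrict (Set.Ioo (ξ 0) (ξ m)) =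
      ∑ j ∈ Finset.range m, volume.restrict (element ξ j) := by
    intro m hm
    induction m with
    | zero => simp
    | succ m ih =>
      rw [Finset.sum_range_succ, ← ih (by omega), element, Measure.restrict_congr_set Ioo_ae_eq_Ioc,
        Measure.restrict_congr_set (Ioo_ae_eq_Ioc (a := ξ 0) (b := ξ m)),
        Measure.restrict_congr_set (Ioo_ae_eq_Ioc (a := ξ m)), ← Measure.restrict_union _
        measurableSet_Ioc, Set.Ioc_union_Ioc_eq_Ioc (h.breakpoint_le (Nat.zero_le m) (by omega))
        (h.lt_succ m (by omega)).le]
      exact Set.Ioc_disjoint_Ioc_of_le le_rfl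
  exact this n le_rfl

lemma eLpNorm_two_sq (f : ℝ → ℝ) (μ : Measure ℝ) :
    eLpNorm f 2 μ ^ 2 = ∫⁻ x, ‖f x‖ₑ ^ 2 ∂μ := by
  have := eLpNorm_nnreal_pow_eq_lintegral (f := f) (μ := μ) (p := 2) (by norm_num)
  simpa using this

/-- Functions on the elements that are derivatives of each other without boundary terms glue to
a weak derivative on the whole interval. -/
lemma IsOpenKnots.hasWeakDeriv_glue (h : IsOpenKnots p n ξ r) {e : ℝ → ℝ} {E₀ E₁ : ℕ → ℝ → ℝ}
    {l : ℕ} (he : ∀ j < n, Set.EqOn e (E₀ j) (element ξ j))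
    (h0 : ∀ j < n, IntegrableOn (E₀ j) (element ξ j))
    (h1 : ∀ j < n, IntegrableOn (E₁ j) (element ξ j))
    (hE : ∀ j < n, ∀ φ : ℝ → ℝ, ContDiff ℝ ∞ φ →
      ∫ x in element ξ j, E₀ j x * iteratedDeriv l φ x =
        (-1) ^ l * ∫ x in element ξ j, E₁ j x * φ x) :
    ∃ G : ℝ → ℝ, HasWeakDeriv l e G (Set.Ioo (ξ 0) (ξ n)) ∧
      eLpNorm G 2 (volume.restrict (Set.Ioo (ξ 0) (ξ n))) ^ 2 =
        ∑ j ∈ Finset.range n, eLpNorm (E₁ j) 2 (volume.restrict (element ξ j)) ^ 2 := by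
  set G : ℝ → ℝ := fun x =>
    ∑ i ∈ Finset.range n, (Set.Ico (ξ i) (ξ (i + 1))).indicator (E₁ i) x with hG
  have hGE : ∀ j < n, Set.EqOn G (E₁ j) (element ξ j) := fun j hj x hx =>
    h.sum_indicator_of_mem E₁ hj ⟨hx.1.le, hx.2⟩
  have hm : ∀ j, MeasurableSet (element ξ j) := fun j => measurableSet_Ioo
  have hei : ∀ j < n, IntegrableOn e (element ξ j) := fun j hj =>
    (h0 j hj).congr_fun (he j hj).symm (hm j)
  have hGi : ∀ j < n, IntegrableOn G (element ξ j) := fun j hj =>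
    (h1 j hj).congr_fun (hGE j hj).symm (hm j)
  have hglob : ∀ f : ℝ → ℝ, (∀ j < n, IntegrableOn f (element ξ j)) →
      IntegrableOn f (Set.Ioo (ξ 0) (ξ n)) := by
    intro f hf
    rw [IntegrableOn, h.restrict_eq_sum, integrable_finsetSum_measure]
    exact fun j hj => hf j (Finset.mem_range.1 hj)
  refine ⟨G, ⟨(hglob e hei).locallyIntegrableOn, (hglob G hGi).locallyIntegrableOn,
    fun φ hφ hφc _ => ?_⟩, ?_⟩
  · have hint : ∀ f ψ : ℝ → ℝ, Continuous ψ → HasCompactSupport ψ → (∀ j < n,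
        IntegrableOn f (element ξ j)) → ∀ j ∈ Finset.range n,
        Integrable (fun x => f x * ψ x) (volume.restrict (element ξ j)) := by
      intro f ψ hψ hψc hf j hj
      obtain ⟨B, hB⟩ := hψc.exists_bound_of_continuous hψ
      exact (hf j (Finset.mem_range.1 hj)).mul_bdd hψ.aestronglyMeasurable
        (Eventually.of_forall hB)
    have hψ := (contDiff_iteratedDeriv_infty hφ l).continuous
    have hψc : HasCompactSupport (iteratedDeriv l φ) :=
      hφc.mono' ((subset_tsupport _).trans (iteratedDeriv_tsupport_subset φ l))
    rw [h.restrict_eq_sum, integral_finsetSum_measure (hint e _ hψ hψc hei),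
      integral_finsetSum_measure (hint G _ hφ.continuous hφc hGi), Finset.mul_sum]
    refine Finset.sum_congr rfl fun j hj => ?_
    have hj := Finset.mem_range.1 hj
    have e0 : ∫ x in element ξ j, e x * iteratedDeriv l φ x =
        ∫ x in element ξ j, E₀ j x * iteratedDeriv l φ x :=
      setIntegral_congr_fun (hm j) fun x hx => congrArg (· * iteratedDeriv l φ x) (he j hj hx)
    have e1 : ∫ x in element ξ j, G x * φ x = ∫ x in element ξ j, E₁ j x * φ x :=
      setIntegral_congr_fun (hm j) fun x hx => congrArg (· * φ x) (hGE j hj hx)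
    rw [e0, e1, hE j hj φ hφ]
  · rw [eLpNorm_two_sq, h.restrict_eq_sum, lintegral_finsetSum_measure]
    refine Finset.sum_congr rfl fun j hj => ?_
    have hj := Finset.mem_range.1 hj
    rw [eLpNorm_two_sq]
    exact setLIntegral_congr_fun (hm j) fun x hx => congrArg (fun y => ‖y‖ₑ ^ 2) (hGE j hj hx)

lemma HasWeakDeriv.of_chain {a b : ℝ} {e E₀ E₁ : ℝ → ℝ} {l : ℕ}
    (he : Set.EqOn e E₀ (Set.Ioo a b)) (h0 : IntegrableOn E₀ (Set.Ioo a b))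
    (h1 : IntegrableOn E₁ (Set.Ioo a b))
    (hE : ∀ φ : ℝ → ℝ, ContDiff ℝ ∞ φ → ∫ x in Set.Ioo a b, E₀ x * iteratedDeriv l φ x =
        (-1) ^ l * ∫ x in Set.Ioo a b, E₁ x * φ x) :
    HasWeakDeriv l e E₁ (Set.Ioo a b) := by
  refine ⟨(h0.congr_fun he.symm measurableSet_Ioo).locallyIntegrableOn, h1.locallyIntegrableOn,
    fun φ hφ _ _ => ?_⟩
  rw [← hE φ hφ]
  exact setIntegral_congr_fun measurableSet_Ioo fun x hx => by simp only [he hx]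

end Interpolant

end HermiteSpline

theorem mainTheorem4 (p : ℕ) (hp : 1 ≤ p) :
    ∃ C : ℝ≥0, ∀ (n : ℕ) (ξ : ℕ → ℝ) (r : ℕ → ℕ), HermiteSpline.IsOpenKnots p n ξ r →
      ∀ u : ℝ → ℝ, HermiteSpline.MemBrokenSobolev p n ξ r u →
        (∃! s : ℝ → ℝ, HermiteSpline.IsHermiteInterpolant p n ξ r u s) ∧
        ∀ s : ℝ → ℝ, HermiteSpline.IsHermiteInterpolant p n ξ r u s →
          (∀ j < n, ∀ l ≤ p,
            HermiteSpline.seminormH l (u - s) (HermiteSpline.element ξ j) ≤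
              C * ENNReal.ofReal (ξ (j + 1) - ξ j) ^ (p + 1 - l) *
                HermiteSpline.seminormH (p + 1) u (HermiteSpline.element ξ j)) ∧
          (∀ l ≤ p, (∀ j, 0 < j → j < n → l ≤ (p - r j) + 1) →
            HermiteSpline.seminormH l (u - s) (Set.Ioo (ξ 0) (ξ n)) ≤
              C * HermiteSpline.meshSize n ξ ^ (p + 1 - l) *
                HermiteSpline.brokenSeminorm (p + 1) n ξ u) := by
  obtain ⟨C, hC⟩ := HermiteSpline.exists_error_chain p hp
  refine ⟨C, fun n ξ r h u hu => ⟨?_, fun s hs => ?_⟩⟩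
  · obtain ⟨s, hs⟩ := HermiteSpline.exists_isHermiteInterpolant h hu
    exact ⟨s, hs, fun s' hs' => hs'.unique h hu hs⟩
  choose! E hE0 hE using hC n ξ r h u hu s hs
  refine ⟨fun j hj l hl => ?_, fun l hl _ => ?_⟩
  · obtain ⟨h1, h2, h3⟩ := hE j hj l hl
    exact (iInf₂_le (E j l) (HermiteSpline.HasWeakDeriv.of_chain (hE0 j hj)
      (hE j hj 0 (Nat.zero_le p)).1 h1 h2)).trans h3
  · obtain ⟨G, hG1, hG2⟩ := h.hasWeakDeriv_glue (l := l) (E₀ := fun j => E j 0)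
      (E₁ := fun j => E j l) hE0 (fun j hj => (hE j hj 0 (Nat.zero_le p)).1)
      (fun j hj => (hE j hj l hl).1) (fun j hj => (hE j hj l hl).2.1)
    refine (iInf₂_le G hG1).trans ?_
    have hroot : ∀ x : ℝ≥0∞, (x ^ 2) ^ (1 / 2 : ℝ) = x := fun x => by
      rw [← ENNReal.rpow_natCast, ← ENNReal.rpow_mul]; norm_num
    rw [← hroot (eLpNorm G 2 _), hG2, HermiteSpline.brokenSeminorm,
      ← hroot (C * HermiteSpline.meshSize n ξ ^ (p + 1 - l)),
      ← ENNReal.mul_rpow_of_nonneg _ _ (by norm_num : (0 : ℝ) ≤ 1 / 2)]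
    refine ENNReal.rpow_le_rpow ?_ (by norm_num)
    rw [Finset.mul_sum]
    refine Finset.sum_le_sum fun j hj => ?_
    rw [← mul_pow]
    have hmesh : ENNReal.ofReal (ξ (j + 1) - ξ j) ≤ HermiteSpline.meshSize n ξ :=
      Finset.le_sup (f := fun j => ENNReal.ofReal (ξ (j + 1) - ξ j)) hj
    refine pow_le_pow_left₀ zero_le ((hE j (Finset.mem_range.1 hj) l hl).2.2.trans ?_) 2
    gcongr
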